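/- Let $E$ be a normed plane, i.e. a two-dimensional real normed space, with closed unit ball $B$ and unit sphere $S$. Assume that $E$ is not angled, i.e. there are no non-collinear points $a,b,c$ with $[a,b]\cup[b,c]\subset S$. Call a bounded set $C\subset E$ complete if no set of the same diameter properly contains $C$. A complete set that is the intersection of finitely many translates of $B$ is called a Reuleaux polygon, and it is said to be $m$-sided if $m$ is the smallest number such that it is the intersection of $m$ translates of $B$. For a bounded set $X$ of diameter $d>0$ and an integer $k\ge 0$, the $k$-fold Borsuk number $a_k(X)$ is the smallest cardinality of a family (repetitions allowed) of subsets of $X$, each of diameter strictly less than $d$, such that every point of $X$ belongs to at least $k$ members of the family. Theorem. Let $C$ be an $m$-sided Reuleaux polygon of diameter one in a not angled normed plane. Then 1. $m$ is odd; 2. if $m=2s+1$, then $s\ge 1$ and, for every $k$, $a_k(C)=2k+\left\lceil \frac{k}{s}\right\rceil$. -/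

import Mathlib

namespace NormedPlane

/-- A real normed space is *angled* if its unit sphere contains two segments `[a, b]` and `[b, c]`
for some non-collinear points `a, b, c`. -/
def IsAngled (E : Type*) [NormedAddCommGroup E] [NormedSpace ℝ E] : Prop :=
  ∃ a b c : E, ¬ Collinear ℝ {a, b, c} ∧
    segment ℝ a b ∪ segment ℝ b c ⊆ Metric.sphere (0 : E) 1

/-- A bounded set is *(diametrically) complete* if no set of the same diameter properly
contains it. (Boundedness of `D` is stated since `Metric.diam` of an unbounded set is `0`.) -/
def IsDiamComplete {E : Type*} [NormedAddCommGroup E] (C : Set E) : Prop :=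
  Bornology.IsBounded C ∧
    ∀ D : Set E, Bornology.IsBounded D → Metric.diam D = Metric.diam C → ¬ C ⊂ D

/-- `C` is the intersection of `n` translates of the closed unit ball. -/
def IsInterUnitBalls {E : Type*} [NormedAddCommGroup E] (C : Set E) (n : ℕ) : Prop :=
  ∃ A : Finset E, A.card = n ∧ C = ⋂ x ∈ A, Metric.closedBall x 1

/-- A *Reuleaux polygon* is a complete set that is the intersection of finitely many translates
of the closed unit ball. -/
def IsReuleauxPolygon {E : Type*} [NormedAddCommGroup E] (C : Set E) : Prop :=
  IsDiamComplete C ∧ ∃ n, IsInterUnitBalls C n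

/-- The set `C` has `m` sides: `m` is the smallest number such that `C` is the intersection of
`m` translates of the closed unit ball. -/
def HasSides {E : Type*} [NormedAddCommGroup E] (C : Set E) (m : ℕ) : Prop :=
  IsLeast {n | IsInterUnitBalls C n} m

/-- A *`k`-fold Borsuk covering* of a bounded set `S`: a finite family (repetitions are allowed)
of subsets of `S`, of diameters strictly less than that of `S`, such that every point of `S`
belongs to at least `k` members of the family. -/
def IsBorsukCovering {E : Type*} [NormedAddCommGroup E] (k : ℕ) (S : Set E) {n : ℕ}
    (F : Fin n → Set E) : Prop :=
  (∀ i, F i ⊆ S ∧ Metric.diam (F i) < Metric.diam S) ∧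
    ∀ x ∈ S, k ≤ Set.ncard {i | x ∈ F i}

/-- The *`k`-fold Borsuk number* of a bounded set `S`: the smallest cardinality of a `k`-fold
Borsuk covering of `S` (it is `⊤` if there is no finite one). -/
noncomputable def borsukNumber {E : Type*} [NormedAddCommGroup E] (k : ℕ) (S : Set E) : ℕ∞ :=
  ⨅ (n : ℕ) (_ : ∃ F : Fin n → Set E, IsBorsukCovering k S F), (n : ℕ∞)

end NormedPlane

/-! Let `V` be a minimal set of centers. By completeness the centers lie in `C`, in fact on its
boundary, a closed convex curve. Everything is read off from the relation "at distance one" along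
this curve. Two diameters whose ends are not interlaced force parallel supporting lines at distance
one, hence a whole rectangle of diameters (`rect`); `corner` expresses that the plane is not angled,
`merge` that it is two-dimensional. After `exists_diametralSystem` the structure of the polygon is
deduced from these axioms alone.

Oddness: by minimality each center owns a private boundary point, at distance one from no other
center. Private points follow the cyclic order of their centers, and the arc between two consecutive
centers is seen at distance one from a center between the two private points
(`exists_center_between`). So the index of the gap that holds the private point grows by at least
one from center to center, and by `m` in a full turn; it is a rotation by some `s`. The private
point of a center then lies on the arc opposite to that center, which forces `m = 2 * s + 1`, and
the diameters between centers contain the odd cycle that joins `i` to `i + s + 1`.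

Lower bound: a set of smaller diameter meets the centers in an independent set of this odd cycle, so
in at most `s` points. Double counting gives `k * (2 * s + 1) ≤ s * n` for a family of `n` sets,
which is the claimed bound (`mul_le_iff_le`).

Upper bound: one cut point can be chosen between any two consecutive centers so that an arc spanning
`s` steps of cut points contains no diameter (`exists_cut_points`). If `k * m ≤ s * n`, then `n`
such arcs, spaced evenly, cover the curve `k` times. Slightly thickened, and joined with the points
far from all ends of diameters, they form a Borsuk covering. -/

/-! ### The diametral relation on a closed curve, axiomatically -/

/-- The order-theoretic properties of the relation `D` "the points with parameters `s` and `t` are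
at diametral distance" on a closed convex curve with a `T`-periodic parametrisation, together with
a sequence `v` enumerating the parameters of the `m` centers of a Reuleaux polygon. -/
structure DiametralSystem (T : ℝ) (m : ℤ) (D : ℝ → ℝ → Prop) (v : ℤ → ℝ) : Prop where
  period_pos : 0 < T
  symm : ∀ {s t}, D s t → D t s
  add_period : ∀ {s t}, D s t → D s (t + T)
  sub_period : ∀ {s t}, D s t → D s (t - T)
  irrefl : ∀ t, ¬ D t t
  isClosed : IsClosed {p : ℝ × ℝ | D p.1 p.2}
  -- Geometrically, the two arcs lie on parallel supporting lines at distance one.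
  rect : ∀ {a a' b b'}, a < a' → a' < b → b < b' → b' < a + T → D a b' → D a' b →
    ∀ {p q}, a ≤ p → p ≤ a' → b ≤ q → q ≤ b' → D p q
  -- This is where the plane being not angled enters: two rectangles sharing the corner `a'`, `b'`
  -- have the same pair of supporting lines.
  corner : ∀ {a a' a'' b b' b''}, a < a' → a' < b → b < b' → b' < a + T → D a b' → D a' b →
    a' < a'' → a'' < b' → b' < b'' → b'' < a' + T → D a' b'' → D a'' b' → D a b'' ∧ D a'' b
  -- This is where dimension two enters: the rectangles of `a₁`, `b₁` and of `a₂`, `b₂` with the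
  -- outer diameter `a`, `b'` have the same supporting lines.
  merge : ∀ {a a₁ a₂ b₁ b₂ b'}, a < a₁ → a₁ < a₂ → a₂ < b₁ → b₁ < b₂ → b₂ < b' → b' < a + T →
    D a b' → D a₁ b₁ → D a₂ b₂ → D a₂ b₁
  pos : 0 < m
  strictMono : StrictMono v
  equivariant : ∀ i, v (i + m) = v i + T
  cover : ∀ t, ∃ i, D t (v i)
  -- This is the trace of the minimality of `m`.
  essential : ∀ i, ∃ z, D z (v i) ∧ ∀ j, D z (v j) → m ∣ j - i

namespace DiametralSystem

variable {T : ℝ} {m : ℤ} {D : ℝ → ℝ → Prop} {v : ℤ → ℝ}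

/-- Reversing the orientation of the curve. -/
theorem reflect (S : DiametralSystem T m D v) :
    DiametralSystem T m (fun s t => D (-s) (-t)) (fun i => -v (-i)) where
  period_pos := S.period_pos
  symm h := S.symm h
  add_period {s t} h := by
    have := S.sub_period h
    rwa [show -(t + T) = -t - T by ring]
  sub_period {s t} h := by
    have := S.add_period h
    rwa [show -(t - T) = -t + T by ring]
  irrefl t := S.irrefl _
  isClosed := by
    have := S.isClosed.preimage (f := fun p : ℝ × ℝ => (-p.1, -p.2)) (by fun_prop)
    exact this
  rect {a a' b b'} h1 h2 h3 h4 h5 h6 {p q} h7 h8 h9 h10 :=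
    S.symm (S.rect (a := -b') (a' := -b) (b := -a') (b' := -a) (by linarith) (by linarith)
      (by linarith) (by linarith) (S.symm h5) (S.symm h6) (by linarith) (by linarith)
      (by linarith) (by linarith))
  corner {a a' a'' b b' b''} h1 h2 h3 h4 h5 h6 h7 h8 h9 h10 h11 h12 := by
    have := S.corner (a := -b'') (a' := -b') (a'' := -b) (b := -a'') (b' := -a') (b'' := -a)
      (by linarith) (by linarith) (by linarith) (by linarith) (S.symm h11) (S.symm h12)
      (by linarith) (by linarith) (by linarith) (by linarith) (S.symm h5) (S.symm h6)
    exact ⟨S.symm this.1, S.symm this.2⟩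
  merge {a a₁ a₂ b₁ b₂ b'} h1 h2 h3 h4 h5 h6 h7 h8 h9 :=
    S.symm (S.merge (a := -b') (a₁ := -b₂) (a₂ := -b₁) (b₁ := -a₂) (b₂ := -a₁) (b' := -a)
      (by linarith) (by linarith) (by linarith) (by linarith) (by linarith) (by linarith)
      (S.symm h7) (S.symm h9) (S.symm h8))
  pos := S.pos
  strictMono i j h := by
    have := S.strictMono (show -j < -i by omega)
    simpa using this
  equivariant i := by
    have := S.equivariant (-(i + m))
    rw [show -(i + m) + m = -i by ring] at this
    linarith
  cover t := by
    obtain ⟨i, hi⟩ := S.cover (-t)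
    exact ⟨-i, by simpa using hi⟩
  essential i := by
    obtain ⟨z, hz, h⟩ := S.essential (-i)
    refine ⟨-z, by simpa using hz, fun j hj => ?_⟩
    have := h (-j) (by simpa using hj)
    rwa [show -j - -i = -(j - i) by ring, dvd_neg] at this

theorem add_mul_period (S : DiametralSystem T m D v) {s t : ℝ} (h : D s t) (k : ℤ) :
    D s (t + k * T) := by
  induction k using Int.induction_on with
  | zero => simpa using h
  | succ k ih =>
    have := S.add_period ih
    rwa [show t + ((k + 1 : ℤ) : ℝ) * T = t + (k : ℤ) * T + T by push_cast; ring]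
  | pred k ih =>
    have := S.sub_period ih
    rwa [show t + ((-k - 1 : ℤ) : ℝ) * T = t + ((-k : ℤ) : ℝ) * T - T by push_cast; ring]

theorem apply_add_mul (S : DiametralSystem T m D v) (i k : ℤ) :
    v (i + m * k) = v i + k * T := by
  induction k using Int.induction_on with
  | zero => simp
  | succ k ih =>
    rw [show i + m * ((k : ℤ) + 1) = i + m * k + m by ring, S.equivariant, ih]
    push_cast; ring
  | pred k ih =>
    have := S.equivariant (i + m * (-(k : ℤ) - 1))
    rw [show i + m * (-(k : ℤ) - 1) + m = i + m * -(k : ℤ) by ring, ih] at this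
    push_cast at this ⊢
    linarith

theorem exists_mem_gap (S : DiametralSystem T m D v) (t : ℝ) : ∃ i, v i ≤ t ∧ t < v (i + 1) := by
  have key : ∀ t : ℝ, ∃ k : ℤ, v (m * k) ≤ t ∧ t < v (m * (k + 1)) := by
    intro t
    have h : ∀ k : ℤ, v (m * k) = v 0 + k * T := fun k => by simpa using S.apply_add_mul 0 k
    refine ⟨⌊(t - v 0) / T⌋, ?_, ?_⟩
    · have := Int.floor_le ((t - v 0) / T)
      rw [le_div_iff₀ S.period_pos] at this
      rw [h]; linarith
    · have := Int.lt_floor_add_one ((t - v 0) / T)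
      rw [div_lt_iff₀ S.period_pos] at this
      rw [h]; push_cast; linarith
  obtain ⟨k, h1, h2⟩ := key t
  obtain ⟨i, hi, hmax⟩ := Int.exists_greatest_of_bdd (P := fun i => v i ≤ t)
    ⟨m * (k + 1), fun i hi => (S.strictMono.lt_iff_lt.1 (lt_of_le_of_lt hi h2)).le⟩ ⟨_, h1⟩
  exact ⟨i, hi, not_le.1 fun h => by have := hmax _ h; omega⟩

theorem exists_translate (S : DiametralSystem T m D v) (y : ℝ) (l : ℤ) (hy : D y (v l)) :
    ∃ l', y < v l' ∧ v l' < y + T ∧ ∀ t, D t (v l) → D t (v l') := by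
  have h := S.apply_add_mul l (-⌊(v l - y) / T⌋)
  have h1 := Int.floor_le ((v l - y) / T)
  have h2 := Int.lt_floor_add_one ((v l - y) / T)
  rw [le_div_iff₀ S.period_pos] at h1
  rw [div_lt_iff₀ S.period_pos] at h2
  have h3 : ∀ t, D t (v l) → D t (v (l + m * -⌊(v l - y) / T⌋)) := fun t ht => by
    rw [h]; exact S.add_mul_period ht _
  push_cast at h
  refine ⟨_, lt_of_le_of_ne (by linarith) fun he => ?_, by linarith, h3⟩
  have := h3 y hy
  rw [← he] at this
  exact S.irrefl y this

theorem isClosed_left (S : DiametralSystem T m D v) (x : ℝ) : IsClosed {t | D t x} :=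
  S.isClosed.preimage (f := fun t : ℝ => (t, x)) (by fun_prop)

theorem left_add_period (S : DiametralSystem T m D v) {s t : ℝ} (h : D s t) : D (s + T) t :=
  S.symm (S.add_period (S.symm h))

theorem apply_sub (S : DiametralSystem T m D v) (i : ℤ) : v (i - m) = v i - T := by
  have := S.equivariant (i - m)
  rw [sub_add_cancel] at this
  linarith

theorem not_dvd_of_lt (S : DiametralSystem T m D v) {i j : ℤ} (h1 : v i < v j)
    (h2 : v j < v i + T) : ¬ m ∣ j - i := by
  rw [← S.equivariant, S.strictMono.lt_iff_lt] at h2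
  rw [S.strictMono.lt_iff_lt] at h1
  intro h
  have := Int.le_of_dvd (by omega) h
  omega

/-- Some center is at diametral distance from points arbitrarily close to `y` before `y`. -/
theorem exists_frequently (S : DiametralSystem T m D v) (y : ℝ) :
    ∃ l, y < v l ∧ v l < y + T ∧ D y (v l) ∧ ∀ x < y, ∃ t, x < t ∧ t < y ∧ D t (v l) := by
  -- Up to the period there are finitely many centers, so one of them serves points accumulating at
  -- `y` from the left.
  have h : ∃ l ∈ Finset.Ico 0 m, ∃ᶠ t in nhdsWithin y (Set.Iio y), D t (v l) := by
    by_contra! hcon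
    have h1 : ∀ᶠ t in nhdsWithin y (Set.Iio y), ∀ l ∈ Finset.Ico 0 m, ¬ D t (v l) := by
      rw [Filter.eventually_all_finset]
      intro l hl
      exact hcon l hl
    obtain ⟨t, ht⟩ := h1.exists
    obtain ⟨i, hi⟩ := S.cover t
    refine ht (i % m) ?_ ?_
    · have := Int.emod_nonneg i S.pos.ne'
      have := Int.emod_lt_of_pos i S.pos
      simp; omega
    · have h2 := S.add_mul_period hi (-(i / m))
      rw [← S.apply_add_mul] at h2
      have := Int.emod_add_mul_ediv i m
      rwa [show i + m * -(i / m) = i % m by linear_combination -this] at h2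
  obtain ⟨l, -, hl⟩ := h
  have hy : D y (v l) := by
    exact (S.isClosed_left (v l)).closure_subset (hl.filter_mono nhdsWithin_le_nhds).mem_closure
  obtain ⟨l', h1, h2, h3⟩ := S.exists_translate y l hy
  refine ⟨l', h1, h2, h3 y hy, fun x hx => ?_⟩
  obtain ⟨t, ht, ht'⟩ := (hl.and_eventually (Ioo_mem_nhdsLT hx)).exists
  exact ⟨t, ht'.1, ht'.2, h3 t ht⟩

/-- The chord of `v i` and a point `z` that has no other center: a diameter `v k`, `y` on one side
of it forces a further center on the other side. -/
theorem exists_center_of_lt (S : DiametralSystem T m D v) {i k : ℤ} {z y : ℝ} (hz1 : v i < z)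
    (hz : D z (v i)) (hpriv : ∀ j, D z (v j) → m ∣ j - i) (hne : ∀ j, z ≠ v j)
    (hk1 : z < v k) (hk2 : v k < y) (hy : y < v i + T) (hD : D (v k) y) :
    ∃ l, v i < v l ∧ v l < z ∧ ∀ q, y ≤ q → q ≤ v i + T → D (v l) q := by
  -- `y₀` is the first point after `z` that is diametral to a center lying between `z` and itself.
  -- Below, `b` is the first point after `v i` that is diametral to `v i`. The two diameters span a
  -- rectangle.
  obtain ⟨y₀, ⟨⟨hy1, hy2⟩, k₀, hk01, hk02, hk0⟩, hmin⟩ : ∃ y₀,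
      IsLeast {q | q ∈ Set.Icc z (v i + T) ∧ ∃ l, z ≤ v l ∧ v l ≤ q ∧ D (v l) q} y₀ := by
    refine IsCompact.exists_isLeast ?_ ⟨y, ⟨by linarith, hy.le⟩, k, hk1.le, hk2.le, hD⟩
    have hfin : {l : ℤ | z ≤ v l ∧ v l ≤ v i + T}.Finite := by
      refine (Set.finite_Icc i (i + m)).subset fun l hl => ⟨?_, ?_⟩
      · exact S.strictMono.le_iff_le.1 (hz1.le.trans hl.1)
      · rw [← S.strictMono.le_iff_le, S.equivariant]; exact hl.2
    have heq : {q | q ∈ Set.Icc z (v i + T) ∧ ∃ l, z ≤ v l ∧ v l ≤ q ∧ D (v l) q} =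
        ⋃ l ∈ {l : ℤ | z ≤ v l ∧ v l ≤ v i + T}, (Set.Icc z (v i + T) ∩ (Set.Ici (v l) ∩
          {q | D q (v l)})) := by
      ext q
      simp only [Set.mem_ofPred_eq, Set.mem_iUnion, Set.mem_inter_iff, Set.mem_Ici]
      constructor
      · rintro ⟨h1, l, h2, h3, h4⟩
        exact ⟨l, ⟨h2, h3.trans h1.2⟩, h1, h3, S.symm h4⟩
      · rintro ⟨l, ⟨h2, -⟩, h1, h3, h4⟩
        exact ⟨h1, l, h2, h3, S.symm h4⟩
    rw [heq]
    exact hfin.isCompact_biUnion fun l _ =>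
      isCompact_Icc.inter_right (isClosed_Ici.inter (S.isClosed_left _))
  have hy0y : y₀ ≤ y := hmin ⟨⟨by linarith, hy.le⟩, k, hk1.le, hk2.le, hD⟩
  replace hk01 : z < v k₀ := lt_of_le_of_ne hk01 (hne _)
  replace hk02 : v k₀ < y₀ := lt_of_le_of_ne hk02 fun h => S.irrefl y₀ (h ▸ hk0)
  obtain ⟨b, ⟨⟨hb1, hb2⟩, hb⟩, hbmin⟩ : ∃ b, IsLeast (Set.Icc (v i) z ∩ {x | D x (v i)}) b :=
    (isCompact_Icc.inter_right (S.isClosed_left _)).exists_isLeast ⟨z, ⟨hz1.le, le_rfl⟩, hz⟩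
  replace hb1 : v i < b := lt_of_le_of_ne hb1 fun h => S.irrefl b (h ▸ hb)
  have hbT : D b (v i + T) := S.add_period hb
  have hrect : ∀ p q, b ≤ p → p ≤ v k₀ → y₀ ≤ q → q ≤ v i + T → D p q := fun p q h1 h2 h3 h4 =>
    S.rect (by linarith) hk02 (by linarith) (by linarith) hbT hk0 h1 h2 h3 h4
  by_contra! hcon
  have hnone : ∀ l, b ≤ v l → v l ≤ z → False := fun l h1 h2 => by
    obtain ⟨q, h3, h4, h5⟩ := hcon l (by linarith) (lt_of_le_of_ne h2 (hne l).symm)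
    exact h5 (hrect _ _ h1 (by linarith) (by linarith) h4)
  have hnotop : ∀ l, y₀ ≤ v l → v l < v i + T → False := fun l h1 h2 =>
    S.not_dvd_of_lt (by linarith) h2 (hpriv l (hrect _ _ hb2 hk01.le h1 h2.le))
  -- Every position of a center `v l` serving points just before `y₀` is impossible: in the
  -- rectangle it would be a center of `z` or the center sought; after `z + T` it contradicts the
  -- choice of `y₀`; and if `v l - T` is before `b`, a center `v r` serving points just before `b`
  -- leads, by `corner` or `rect`, to a partner of `v i` before `b`.
  obtain ⟨l, hl1, hl2, hl3, hl4⟩ := S.exists_frequently y₀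
  rcases lt_or_ge (v l) (v i + T) with h | h
  · exact hnotop l hl1.le h
  have hlm := S.apply_sub l
  rcases lt_or_ge (v l) (b + T) with h' | h'
  · obtain ⟨r, hr1, hr2, hr3, hr4⟩ := S.exists_frequently b
    rcases lt_or_ge (v r) y₀ with h2 | h2
    · have := (S.corner (a := v l - T) (a' := b) (a'' := v k₀) (b := v r) (b' := y₀)
        (b'' := v i + T) (by linarith) hr1 h2 (by linarith) (S.symm (S.sub_period hl3)) hr3
        (by linarith) hk02 (by linarith) (by linarith) hbT hk0).1
      have h3 := S.sub_period this
      rw [add_sub_cancel_right] at h3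
      have := hbmin ⟨⟨by linarith, by linarith⟩, h3⟩
      linarith
    rcases lt_or_ge (v r) (v i + T) with h3 | h3
    · exact hnotop r h2 h3
    obtain ⟨t, ht1, ht2, ht3⟩ := hr4 (v r - T) (by linarith)
    have ht : D t (v i) := by
      rcases h3.eq_or_lt with h4 | h4
      · have := S.sub_period ht3
        rwa [← h4, add_sub_cancel_right] at this
      · exact S.symm (S.rect (a := v i) (a' := v r - T) (b := t) (b' := b) (by linarith) ht1 ht2
          (by linarith) (S.symm hb) (S.symm (S.sub_period ht3)) le_rfl (by linarith) le_rfl ht2.le)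
    have := hbmin ⟨⟨by linarith, by linarith⟩, ht⟩
    linarith
  rcases le_or_gt (v l) (z + T) with h'' | h''
  · exact hnone (l - m) (by linarith) (by linarith)
  · obtain ⟨t, ht1, ht2, ht3⟩ := hl4 (v (l - m)) (by linarith)
    have := hmin ⟨⟨by linarith, by linarith⟩, l - m, by linarith, ht1.le,
      by rw [hlm]; exact S.symm (S.sub_period ht3)⟩
    linarith

/-- The mirror image of `exists_center_of_lt`. -/
theorem exists_center_of_gt (S : DiametralSystem T m D v) {i k : ℤ} {z y : ℝ}
    (hz2 : z < v i + T) (hz : D z (v i)) (hpriv : ∀ j, D z (v j) → m ∣ j - i)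
    (hne : ∀ j, z ≠ v j) (hy : v i < y) (hk1 : y < v k) (hk2 : v k < z) (hD : D (v k) y) :
    ∃ l, z < v l ∧ v l < v i + T ∧ ∀ q, v i ≤ q → q ≤ y → D (v l) q := by
  -- The reflection used is `t ↦ -t + T`; it carries the window after `v i` to the window after `-v
  -- i`, the center with index `-i` of the reflected system.
  have hs : ∀ x t : ℝ, D x (-(-t + T)) ↔ D x t := fun x t =>
    by
    rw [show -(-t + T) = t - T by ring]
    exact ⟨fun h => by simpa using S.add_period h, S.sub_period⟩
  have hs' : ∀ x t : ℝ, D (-(-t + T)) x ↔ D t x := fun x t =>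
    ⟨fun h => S.symm ((hs _ _).1 (S.symm h)), fun h => S.symm ((hs _ _).2 (S.symm h))⟩
  have hkm : -v (-(-k + m)) = -v k + T := by
    rw [show -(-k + m) = k - m by ring, S.apply_sub]; ring
  obtain ⟨l, h1, h2, h3⟩ := S.reflect.exists_center_of_lt (i := -i) (k := -k + m) (z := -z + T)
    (y := -y + T) (by simp; linarith) (by rw [hs', neg_neg, neg_neg]; exact hz)
    (fun j hj => by
      have := hpriv (-j) ((hs' _ _).1 (by rwa [neg_neg] at hj))
      rwa [show -j - i = -(j - -i) by ring, dvd_neg] at this)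
    (fun j hj => by
      exact hne (-j + m) (by rw [S.equivariant]; linarith))
    (by rw [hkm]; linarith) (by rw [hkm]; linarith) (by simp; linarith)
    (by rw [hkm, hs, hs']; exact hD)
  simp only [neg_neg] at h1
  refine ⟨-l + m, by rw [S.equivariant]; linarith, by rw [S.equivariant]; linarith,
    fun q hq1 hq2 => ?_⟩
  have := h3 (-q + T) (by linarith) (by simp; linarith)
  rw [hs, neg_neg] at this
  rw [S.equivariant]
  exact S.left_add_period this

end DiametralSystem

/-! ### Private points and the cyclic structure of the centers -/

namespace DiametralSystem

variable {T : ℝ} {m : ℤ} {D : ℝ → ℝ → Prop} {v : ℤ → ℝ}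

theorem center_of_dvd (S : DiametralSystem T m D v) {t : ℝ} {i j : ℤ} (h : D t (v i))
    (hij : m ∣ j - i) : D t (v j) := by
  obtain ⟨k, hk⟩ := hij
  have := S.add_mul_period h k
  rwa [← S.apply_add_mul, ← hk, add_sub_cancel] at this

/-- Choose on the residues `0, …, m - 1` and translate, so that the choices respect the period. -/
theorem exists_equivariant (S : DiametralSystem T m D v) {P : ℤ → ℝ → Prop}
    (hP : ∀ i x, P i x → ∀ k : ℤ, P (i + m * k) (x + k * T)) (h : ∀ i, ∃ x, P i x) :
    ∃ f : ℤ → ℝ, (∀ i, P i (f i)) ∧ ∀ i, f (i + m) = f i + T := by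
  choose f hf using h
  refine ⟨fun i => f (i % m) + (i / m : ℤ) * T, fun i => ?_, fun i => ?_⟩
  · have := hP _ _ (hf (i % m)) (i / m)
    rwa [Int.emod_add_mul_ediv] at this
  · simp only [Int.add_emod_right]
    rw [Int.add_ediv_of_dvd_right (dvd_refl m), Int.ediv_self S.pos.ne']
    push_cast; ring

/-- `x` is a parameter between `v i` and `v i + T` whose only center is `v i`. -/
structure IsPrivate (T : ℝ) (m : ℤ) (D : ℝ → ℝ → Prop) (v : ℤ → ℝ) (i : ℤ) (x : ℝ) : Prop where
  gt : v i < x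
  lt : x < v i + T
  center : D x (v i)
  dvd : ∀ j, D x (v j) → m ∣ j - i
  ne : ∀ j, x ≠ v j

theorem IsPrivate.translate {i : ℤ} {x : ℝ} (h : IsPrivate T m D v i x)
    (S : DiametralSystem T m D v) (k : ℤ) : IsPrivate T m D v (i + m * k) (x + k * T) := by
  have hv := S.apply_add_mul i k
  refine ⟨by linarith [h.gt], by linarith [h.lt], ?_, fun j hj => ?_, fun j hj => ?_⟩
  · rw [hv]
    exact S.symm (S.add_mul_period (S.symm (S.add_mul_period h.center k)) k)
  · have h1 := S.symm (S.add_mul_period (S.symm hj) (-k))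
    rw [show x + k * T + ((-k : ℤ) : ℝ) * T = x by push_cast; ring] at h1
    have h2 := h.dvd j h1
    rw [show j - (i + m * k) = j - i - m * k by ring]
    exact dvd_sub h2 (dvd_mul_right _ _)
  · apply h.ne (j + m * -k)
    rw [S.apply_add_mul, ← hj]; push_cast; ring

/-- Move an essential point slightly to the right: by closedness no foreign center is gained, so the
covering leaves only `v i`, and a small move avoids the centers themselves. -/
theorem exists_isPrivate (S : DiametralSystem T m D v) (i : ℤ) :
    ∃ x, IsPrivate T m D v i x := by
  obtain ⟨z, -, hz⟩ := S.essential i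
  have h1 : ∀ᶠ t in nhdsWithin z (Set.Ioi z), ∀ l ∈ Finset.Ico 0 m, D t (v l) → m ∣ l - i := by
    rw [Filter.eventually_all_finset]
    intro l _
    by_cases hl : m ∣ l - i
    · exact Filter.Eventually.of_forall fun _ _ => hl
    · have : ∀ᶠ t in nhds z, ¬ D t (v l) :=
        (S.isClosed_left (v l)).isOpen_compl.mem_nhds fun h => hl (hz l h)
      exact (Filter.Eventually.filter_mono nhdsWithin_le_nhds this).mono fun t ht h => absurd h ht
  obtain ⟨a, ha1, ha2⟩ := S.exists_mem_gap z
  obtain ⟨t, ht, ht1, ht2⟩ := (h1.and (Ioo_mem_nhdsGT ha2)).exists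
  have hdvd : ∀ j, D t (v j) → m ∣ j - i := fun j hj => by
    have hmod : m ∣ j % m - j := ⟨-(j / m), by linear_combination Int.emod_add_mul_ediv j m⟩
    have h2 := ht (j % m) (by
      have := Int.emod_nonneg j S.pos.ne'
      have := Int.emod_lt_of_pos j S.pos
      simp; omega) (S.center_of_dvd hj hmod)
    have := dvd_sub h2 hmod
    rwa [show j % m - i - (j % m - j) = j - i by ring] at this
  obtain ⟨j, hj⟩ := S.cover t
  have hti : D t (v i) := S.center_of_dvd hj (by rw [← dvd_neg, neg_sub]; exact hdvd j hj)
  have hne : ∀ j, t ≠ v j := fun j hj => by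
    rw [hj] at ht1 ht2
    rw [S.strictMono.lt_iff_lt] at ht2
    have := S.strictMono.lt_iff_lt.1 (ha1.trans_lt ht1)
    omega
  have h2 := Int.floor_le ((t - v i) / T)
  have h3 := Int.lt_floor_add_one ((t - v i) / T)
  rw [le_div_iff₀ S.period_pos] at h2
  rw [div_lt_iff₀ S.period_pos] at h3
  set k := ⌊(t - v i) / T⌋
  have hk := S.apply_add_mul i k
  have hbase : IsPrivate T m D v (i + m * k) t := by
    refine ⟨lt_of_le_of_ne (by linarith) (hne _).symm, by linarith,
      S.center_of_dvd hti (by simp), fun j hj => ?_, hne⟩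
    rw [show j - (i + m * k) = j - i - m * k by ring]
    exact dvd_sub (hdvd j hj) (dvd_mul_right _ _)
  have := hbase.translate S (-k)
  rw [show i + m * k + m * -k = i by ring] at this
  exact ⟨_, this⟩

/-- In the opposite order the diameters `v i`, `x` and `v j`, `y` would span a rectangle containing
`v j`, `x`, making `v j` a second center of `x`. -/
theorem IsPrivate.lt_of_lt {i j : ℤ} {x y : ℝ} (S : DiametralSystem T m D v)
    (hx : IsPrivate T m D v i x) (hy : IsPrivate T m D v j y) (hij : i < j) : x < y := by
  have hv := S.strictMono hij
  rcases le_or_gt x (v j) with h | h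
  · exact h.trans_lt hy.gt
  have hno : ¬ D x (v j) := fun h' => S.not_dvd_of_lt hv (by linarith [hx.lt]) (hx.dvd j h')
  by_contra! hle
  rcases hle.eq_or_lt with h' | h'
  · exact hno (h' ▸ hy.center)
  · exact hno (S.symm (S.rect hv hy.gt h' hx.lt (S.symm hx.center) (S.symm hy.center) hv.le le_rfl
      h'.le le_rfl))

/-- If the center found for `t` lies beyond `y` or before `x`, the chord at that private point
supplies another center of `t` on its other side. Overshooting both private points would create a
rectangle giving one of them a foreign center. -/
theorem exists_center_between (S : DiametralSystem T m D v) {i j : ℤ} {x y t : ℝ}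
    (hx : IsPrivate T m D v i x) (hy : IsPrivate T m D v j y) (hj : v j < v i + T)
    (hit : v i < t) (htj : t < v j) : ∃ l, x < v l ∧ v l < y ∧ D t (v l) := by
  have hij : ¬ m ∣ j - i := S.not_dvd_of_lt (hit.trans htj) hj
  have hji : ¬ m ∣ i - j := by rwa [← dvd_neg, neg_sub]
  have hxy : x < y := hx.lt_of_lt S hy (S.strictMono.lt_iff_lt.1 (hit.trans htj))
  obtain ⟨l₀, hl₀⟩ := S.cover t
  obtain ⟨l, hl1, hl2, hl⟩ := S.exists_translate t l₀ hl₀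
  replace hl := hl t hl₀
  rcases lt_or_gt_of_ne (hx.ne l) with h1 | h1
  · rcases lt_or_gt_of_ne (hy.ne l) with h2 | h2
    · obtain ⟨l', h3, h4, h5⟩ := S.exists_center_of_lt hy.gt hy.center hy.dvd hy.ne h2 hl2
        (by linarith) (S.add_period (S.symm hl))
      rcases lt_or_gt_of_ne (hx.ne l') with h6 | h6
      · exact ⟨l', h6, h4, S.symm (by simpa using S.sub_period (h5 _ le_rfl (by linarith)))⟩
      · refine absurd (hx.dvd j ?_) hij
        have := S.rect (a := v l') (a' := v l) (b := t + T) (b' := v j + T) (by linarith) hl2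
          (by linarith) (by linarith) (h5 _ (by linarith) le_rfl) (S.add_period (S.symm hl))
          (p := x) (q := v j + T) (by linarith) (by linarith) (by linarith) le_rfl
        simpa using S.sub_period this
    · exact ⟨l, h1, h2, hl⟩
  · obtain ⟨l', h3, h4, h5⟩ := S.exists_center_of_gt hx.lt hx.center hx.dvd hx.ne hit hl1 h1
      (S.symm hl)
    rcases lt_or_gt_of_ne (hy.ne l') with h6 | h6
    · refine absurd (hy.dvd i ?_) hji
      exact S.symm (S.rect (a := v i) (a' := t) (b := v l) (b' := v l') hit hl1 (by linarith) h4
        (S.symm (h5 _ le_rfl hit.le)) hl le_rfl hit.le (by linarith) (by linarith))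
    · exact ⟨l', h3, h6, S.symm (h5 _ hit.le le_rfl)⟩

theorem one_lt (S : DiametralSystem T m D v) : 1 < m := by
  have := S.pos
  by_contra! h
  obtain rfl : m = 1 := by omega
  obtain ⟨i, hi⟩ := S.cover (v 0)
  exact S.irrefl _ (S.center_of_dvd (j := 0) hi (one_dvd _))

/-- The cyclic structure of the centers: their number is `2 * s + 1`, and the arc from `v i` to
`v (i + 1)` lies on the sphere around `v (i + s + 1)`. -/
theorem exists_cyclic_structure (S : DiametralSystem T m D v) :
    ∃ s : ℤ, 1 ≤ s ∧ m = 2 * s + 1 ∧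
      (∀ i x, IsPrivate T m D v i x → v (i + s) < x ∧ x < v (i + s + 1)) ∧
      ∀ i t, v i ≤ t → t ≤ v (i + 1) → D t (v (i + s + 1)) := by
  have hm := S.one_lt
  have hnext : ∀ i, v (i + 1) < v i + T := fun i => by
    rw [← S.equivariant]; exact S.strictMono (by omega)
  obtain ⟨z, hz, hzm⟩ := S.exists_equivariant (P := IsPrivate T m D v)
    (fun i x h k => h.translate S k) S.exists_isPrivate
  -- `c i` is the index of the gap between consecutive centers that contains the private point `z
  -- i`.
  choose c hc1 hc2 using fun i => S.exists_mem_gap (z i)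
  replace hc1 : ∀ i, v (c i) < z i := fun i => lt_of_le_of_ne (hc1 i) ((hz i).ne _).symm
  have hstep : ∀ i, c i + 1 ≤ c (i + 1) := fun i => by
    obtain ⟨l, h1, h2, -⟩ := S.exists_center_between (hz i) (hz (i + 1)) (hnext i)
      (t := (v i + v (i + 1)) / 2) (by linarith [S.strictMono (show i < i + 1 by omega)])
      (by linarith [S.strictMono (show i < i + 1 by omega)])
    have h3 := S.strictMono.lt_iff_lt.1 ((hc1 i).trans h1)
    have h4 := S.strictMono.lt_iff_lt.1 (h2.trans (hc2 (i + 1)))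
    omega
  have hcm : ∀ i, c (i + m) = c i + m := fun i => by
    have h1 : v (c i + m) < v (c (i + m) + 1) := by
      rw [S.equivariant]; linarith [hc1 i, hc2 (i + m), hzm i]
    have h2 : v (c (i + m)) < v (c i + 1 + m) := by
      rw [S.equivariant]; linarith [hc2 i, hc1 (i + m), hzm i]
    have h3 := S.strictMono.lt_iff_lt.1 h1
    have h4 := S.strictMono.lt_iff_lt.1 h2
    omega
  have hsum : ∀ (n : ℕ) i, c i + n ≤ c (i + n) := fun n i => by
    induction n with
    | zero => simp
    | succ n ih =>
      have := hstep (i + n)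
      push_cast
      rw [show i + ((n : ℤ) + 1) = i + n + 1 by ring]; omega
  -- Each of `m` steps contributes at least one and together they contribute `m`.
  have hstep' : ∀ i, c (i + 1) = c i + 1 := fun i => by
    have h1 := hsum (m - 1).toNat (i + 1)
    rw [Int.toNat_of_nonneg (by omega), show i + 1 + (m - 1) = i + m by ring, hcm] at h1
    have := hstep i
    omega
  have hc : ∀ i, c i = i + c 0 := fun i => by
    induction i using Int.induction_on with
    | zero => simp
    | succ k ih => rw [hstep', ih]; ring
    | pred k ih =>
      have := hstep' (-k - 1)
      rw [sub_add_cancel, ih] at this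
      omega
  have hgap : ∀ i x, IsPrivate T m D v i x → v (i + c 0) < x ∧ x < v (i + c 0 + 1) := by
    intro i x hx
    constructor
    · obtain ⟨l, h1, h2, -⟩ := S.exists_center_between (hz (i - 1)) hx
        (by have := hnext (i - 1); rwa [sub_add_cancel] at this)
        (t := (v (i - 1) + v i) / 2) (by linarith [S.strictMono (show i - 1 < i by omega)])
        (by linarith [S.strictMono (show i - 1 < i by omega)])
      have h3 := S.strictMono.lt_iff_lt.1 ((hc1 _).trans h1)
      rw [hc] at h3
      exact (S.strictMono.monotone (by omega)).trans_lt h2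
    · obtain ⟨l, h1, h2, -⟩ := S.exists_center_between hx (hz (i + 1)) (hnext i)
        (t := (v i + v (i + 1)) / 2) (by linarith [S.strictMono (show i < i + 1 by omega)])
        (by linarith [S.strictMono (show i < i + 1 by omega)])
      have h3 := S.strictMono.lt_iff_lt.1 (h2.trans (hc2 _))
      rw [hc] at h3
      exact h1.trans_le (S.strictMono.monotone (by omega))
  have harc : ∀ i t, v i < t → t < v (i + 1) → D t (v (i + c 0 + 1)) := fun i t h1 h2 => by
    obtain ⟨l, h3, h4, h5⟩ := S.exists_center_between (hz i) (hz (i + 1)) (hnext i) h1 h2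
    have h6 := S.strictMono.lt_iff_lt.1 ((hgap _ _ (hz i)).1.trans h3)
    have h7 := S.strictMono.lt_iff_lt.1 (h4.trans (hgap _ _ (hz (i + 1))).2)
    rwa [show i + c 0 + 1 = l by omega]
  have harc' : ∀ i t, v i ≤ t → t ≤ v (i + 1) → D t (v (i + c 0 + 1)) := fun i t h1 h2 => by
    have h3 : closure (Set.Ioo (v i) (v (i + 1))) ⊆ {t | D t (v (i + c 0 + 1))} :=
      closure_minimal (fun t ht => harc i t ht.1 ht.2) (S.isClosed_left _)
    rw [closure_Ioo (S.strictMono (by omega)).ne] at h3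
    exact h3 ⟨h1, h2⟩
  -- The private point of `v 0` lies on the arc after `v (c 0)`, which is served by `v (2 * c 0 +
  -- 1)`; privacy identifies this center with `v 0`. Since `0 ≤ c 0 < m`, the quotient is one.
  have hdvd : m ∣ 2 * c 0 + 1 := by
    have h1 := hgap 0 _ (hz 0)
    have h2 := (hz 0).dvd _ (harc _ _ h1.1 h1.2)
    rwa [show 0 + c 0 + c 0 + 1 - 0 = 2 * c 0 + 1 by ring] at h2
  have h0 := hgap 0 _ (hz 0)
  have hlo : -1 < c 0 := by
    have := S.strictMono.lt_iff_lt.1 ((hz 0).gt.trans h0.2)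
    omega
  have hhi : c 0 < m := by
    have := (h0.1.trans (hz 0).lt)
    rw [← S.equivariant, S.strictMono.lt_iff_lt] at this
    omega
  obtain ⟨k, hk⟩ := hdvd
  obtain rfl : k = 1 := by
    have : 0 < k := by
      by_contra! h; nlinarith
    have : k < 2 := by
      by_contra! h; nlinarith
    omega
  exact ⟨c 0, by omega, by omega, hgap, harc'⟩

end DiametralSystem

/-! ### Cut points, coverings by arcs, independent sets of centers -/

namespace DiametralSystem

variable {T : ℝ} {m : ℤ} {D : ℝ → ℝ → Prop} {v : ℤ → ℝ}

/-- There are cutting points, one on each arc between consecutive centers, such that the closed arc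
from a cutting point to the `s`-th next one contains no diameter. -/
theorem exists_cut_points (S : DiametralSystem T m D v) {s : ℤ} (hs : 1 ≤ s) (hm : m = 2 * s + 1)
    (hpriv : ∀ i x, IsPrivate T m D v i x → v (i + s) < x ∧ x < v (i + s + 1))
    (harc : ∀ i t, v i ≤ t → t ≤ v (i + 1) → D t (v (i + s + 1))) :
    ∃ h : ℤ → ℝ, StrictMono h ∧ (∀ i, h (i + m) = h i + T) ∧
      ∀ i a b, h i ≤ a → a < b → b ≤ h (i + s) → ¬ D a b := by
  -- Points of the gap opposite to `v i` whose only partner is `v i`. They are the preferred cut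
  -- points; a private point is taken only if the gap has none of them.
  let U : ℤ → ℝ → Prop := fun i x =>
    v (i + s) < x ∧ x < v (i + s + 1) ∧ ∀ y, x < y → y < x + T → D x y → y = v i + T
  have hU : ∀ i x, U i x → ∀ k : ℤ, U (i + m * k) (x + k * T) := fun i x h k => by
    have hv : ∀ j, v (j + m * k) = v j + k * T := fun j => S.apply_add_mul j k
    refine ⟨?_, ?_, fun y h1 h2 h3 => ?_⟩
    · rw [show i + m * k + s = i + s + m * k by ring, hv]; linarith [h.1]
    · rw [show i + m * k + s + 1 = i + s + 1 + m * k by ring, hv]; linarith [h.2.1]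
    · have h4 := S.symm (S.add_mul_period (S.symm (S.add_mul_period h3 (-k))) (-k))
      rw [show x + k * T + ((-k : ℤ) : ℝ) * T = x by push_cast; ring] at h4
      have := h.2.2 _ (by push_cast; linarith) (by push_cast; linarith) h4
      push_cast at this
      rw [hv]; linarith
  obtain ⟨h, hh, hhm⟩ := S.exists_equivariant
    (P := fun i x => U i x ∨ ((∀ x, ¬ U i x) ∧ IsPrivate T m D v i x))
    (fun i x h k => h.imp (fun h => hU i x h k) fun h => ⟨fun y hy => h.1 (y + ((-k : ℤ) : ℝ) * T)
      (by have := hU _ _ hy (-k); rwa [show i + m * k + m * -k = i by ring] at this),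
      h.2.translate S k⟩)
    (fun i => by
      by_cases hi : ∃ x, U i x
      · exact ⟨_, Or.inl hi.choose_spec⟩
      · push Not at hi
        obtain ⟨x, hx⟩ := S.exists_isPrivate i
        exact ⟨x, Or.inr ⟨hi, hx⟩⟩)
  have hgap : ∀ i, v (i + s) < h i ∧ h i < v (i + s + 1) := fun i => by
    rcases hh i with h1 | h1
    · exact ⟨h1.1, h1.2.1⟩
    · exact hpriv i _ h1.2
  have hper : ∀ i, v (i + 2 * s + 1) = v i + T := fun i => by
    rw [← S.equivariant, hm, add_assoc]
  refine ⟨h, strictMono_int_of_lt_succ fun i => ?_, hhm, ?_⟩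
  · have h1 := (hgap (i + 1)).1
    rw [show i + 1 + s = i + s + 1 by ring] at h1
    exact (hgap i).2.trans h1
  have hmono : ∀ {i j : ℤ}, i < j → v i < v j := fun hij => S.strictMono hij
  -- If the two cut points were partners, neither would satisfy `U`, so both are private and every
  -- point of the gap of `h i` has a partner other than `v i + T`.
  have hend : ∀ i, ¬ D (h i) (h (i + s)) := by
    intro i hD
    have hα := hgap i
    have hβ := hgap (i + s)
    rw [show i + s + s = i + 2 * s by ring, hper] at hβ
    have h1 : v (i + s + 1) ≤ v (i + 2 * s) := S.strictMono.monotone (by omega)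
    have h2 : v i + T < v (i + s) + T := by linarith [hmono (show i < i + s by omega)]
    have hwv : ∀ t, v (i + s) ≤ t → t ≤ v (i + s + 1) → D t (v i + T) := fun t h3 h4 => by
      have := harc (i + s) t h3 h4
      rwa [show i + s + s + 1 = i + 2 * s + 1 by ring, hper] at this
    obtain ⟨hnU, hα'⟩ := (hh i).resolve_left fun hUi => by
      have := hUi.2.2 _ (by linarith) (by linarith) hD
      linarith
    have hβ' : IsPrivate T m D v (i + s) (h (i + s)) :=
      ((hh (i + s)).resolve_left fun hUi => by
        have := hUi.2.2 (h i + T) (by linarith) (by linarith) (S.add_period (S.symm hD))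
        linarith).2
    have hαno : ¬ D (h i) (v (i + s + 1)) := fun h' => by
      have h3 := Int.le_of_dvd (by omega) (hα'.dvd _ h')
      omega
    have hβno : ¬ D (v (i + s + 1)) (h (i + s)) := fun h' => by
      have h3 := Int.le_of_dvd (by omega) (hβ'.dvd _ (S.symm h'))
      omega
    generalize h i = α at *
    generalize h (i + s) = β at *
    -- `e` is the last point of the gap diametral to `β`. The additional partners of later points
    -- must lie beyond `v i + T`, since otherwise `rect` or `merge` would make such a point a
    -- partner of `β`.
    obtain ⟨e, ⟨⟨he1, he2⟩, he⟩, hmax⟩ : ∃ e,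
        IsGreatest (Set.Icc (v (i + s)) (v (i + s + 1)) ∩ {x | D x β}) e :=
      (isCompact_Icc.inter_right (S.isClosed_left β)).exists_isGreatest
        ⟨α, ⟨hα.1.le, hα.2.le⟩, hD⟩
    have hαe : α ≤ e := hmax ⟨⟨hα.1.le, hα.2.le⟩, hD⟩
    have hcon : ∀ t, e < t → t ≤ v (i + s + 1) → ¬ D t β := fun t h3 h4 h5 =>
      h3.not_ge (hmax ⟨⟨by linarith, h4⟩, h5⟩)
    replace he2 : e < v (i + s + 1) := lt_of_le_of_ne he2 fun h' => hβno (h' ▸ he)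
    have key : ∀ t, e < t → t < v (i + s + 1) → ∃ y, v i + T < y ∧ y < e + T ∧ D t y := by
      intro t ht1 ht2
      obtain ⟨y, hy1, hy2, hy3, hy4⟩ : ∃ y, t < y ∧ y < t + T ∧ D t y ∧ y ≠ v i + T := by
        by_contra! hno
        exact hnU t ⟨by linarith, ht2, fun y h3 h4 h5 => hno y h3 h4 h5⟩
      have hyv : v i + T < y := by
        by_contra! hle
        replace hle := lt_of_le_of_ne hle hy4
        refine hcon t ht1 ht2.le ?_
        rcases lt_trichotomy y β with h3 | h3 | h3
        · exact S.rect ht1 hy1 h3 (by linarith) he hy3 ht1.le le_rfl h3.le le_rfl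
        · exact h3 ▸ hy3
        · exact S.merge (a := v (i + s)) (a₁ := α) (b' := v i + T) hα.1 (by linarith) (by linarith)
            h3 hle (by linarith) (hwv _ le_rfl (by linarith)) hD hy3
      refine ⟨y, hyv, ?_, hy3⟩
      by_contra! hge
      have h3 : D t (y - T) := S.sub_period hy3
      refine hαno (S.rect (a := v (i + s)) (a' := y - T) (b := t) (b' := v i + T) (by linarith)
        (by linarith) (by linarith) (by linarith) (hwv _ le_rfl (by linarith)) (S.symm h3)
        (by linarith) (by linarith) ht2.le (by linarith))
    obtain ⟨t₁, ht1, ht2⟩ := exists_between he2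
    obtain ⟨y₁, hy1, hy2, hy3⟩ := key t₁ ht1 ht2
    -- Every point between `e` and `t₁` is also a partner of `y₁`; let it tend to `e`. Then `corner`
    -- at `e`, `v i + T` makes `v (i + s + 1)` a center of `β`, against privacy.
    have hey : D e y₁ := by
      have h3 : closure (Set.Ioo e t₁) ⊆ {t | D t y₁} := by
        refine closure_minimal (fun t ht => ?_) (S.isClosed_left _)
        obtain ⟨y, h4, h5, h6⟩ := key t ht.1 (ht.2.trans ht2)
        rcases le_or_gt y₁ y with h7 | h7
        · exact S.rect (a := t) (a' := v (i + s + 1)) (b := v i + T) (b' := y) (ht.2.trans ht2)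
            (by linarith) h4 (by linarith [ht.1]) h6 (hwv _ (by linarith) le_rfl) le_rfl
            (ht.2.trans ht2).le hy1.le h7
        · have := S.merge (a := v i + T) (a₁ := y) (a₂ := y₁) (b₁ := t + T) (b₂ := t₁ + T)
            (b' := v (i + s + 1) + T) h4 h7 (by linarith [ht.1]) (by linarith [ht.2])
            (by linarith) (by linarith)
            (S.add_period (S.symm (hwv _ (by linarith) le_rfl))) (S.add_period (S.symm h6))
            (S.add_period (S.symm hy3))
          exact S.symm (by simpa using S.sub_period this)
      rw [closure_Ioo ht1.ne] at h3
      exact h3 ⟨le_rfl, ht1.le⟩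
    exact hβno (S.corner (a := v (i + s)) (a' := e) (a'' := v (i + s + 1)) (b := β)
      (b' := v i + T) (b'' := y₁) (by linarith) (by linarith) (by linarith) (by linarith)
      (hwv _ le_rfl (by linarith)) he he2 (by linarith) hy1 hy2 hey
      (hwv _ (by linarith) le_rfl)).2
  -- A diameter inside the arc is pushed out to its ends by two rectangles, spanned with `h i`, `v i
  -- + T` and with `v (i + s)`, `h (i + s)`.
  intro i a b ha hab hb hD
  have hα := hgap i
  have hβ := hgap (i + s)
  have hup := harc (i + s) (h i) hα.1.le hα.2.le
  rw [show i + s + s + 1 = i + 2 * s + 1 by ring, hper] at hup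
  rw [show i + s + s = i + 2 * s by ring, hper] at hβ
  have hlow : D (v (i + s)) (h (i + s)) := by
    have := harc (i + 2 * s) (h (i + s)) hβ.1.le (by rw [hper]; exact hβ.2.le)
    rw [show i + 2 * s + s + 1 = i + s + m by rw [hm]; ring, S.equivariant] at this
    simpa using S.symm (S.sub_period this)
  have hiT : v i + T < v (i + s) + T := by linarith [hmono (show i < i + s by omega)]
  have h1 : D (h i) b := by
    rcases ha.eq_or_lt with h1 | h1
    · exact h1 ▸ hD
    · exact S.rect h1 hab (by linarith) (by linarith) hup hD le_rfl ha le_rfl (by linarith)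
  rcases hb.eq_or_lt with h2 | h2
  · exact hend i (h2 ▸ h1)
  · exact hend i (S.rect hα.1 (by linarith) h2 (by linarith) hlow h1 hα.1.le le_rfl h2.le le_rfl)

/-- Every curve with a diametral system has a `k`-fold covering by `n` closed arcs without
diameters as soon as `k * m ≤ s * n`. -/
theorem exists_arc_covering (S : DiametralSystem T m D v) {s : ℤ} (hs : 1 ≤ s)
    (hm : m = 2 * s + 1)
    (hpriv : ∀ i x, IsPrivate T m D v i x → v (i + s) < x ∧ x < v (i + s + 1))
    (harc : ∀ i t, v i ≤ t → t ≤ v (i + 1) → D t (v (i + s + 1)))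
    {k n : ℕ} (hn : 0 < n) (hkn : k * m ≤ s * n) :
    ∃ lo hi : Fin n → ℝ, (∀ j a b, lo j ≤ a → a < b → b ≤ hi j → ¬ D a b) ∧
      ∀ t, k ≤ Set.ncard {j | ∃ r : ℤ, lo j ≤ t + r * T ∧ t + r * T ≤ hi j} := by
  obtain ⟨h, hmono, hh, hcut⟩ := S.exists_cut_points hs hm hpriv harc
  have hn' : (0 : ℤ) < n := by exact_mod_cast hn
  -- Rounding down `j * m / n` spaces `n` starting points evenly over the `m` cut points of a
  -- period. Advancing by `k` advances the cut index by at most `s`, because `k * m ≤ s * n`.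
  let g : ℤ → ℝ := fun j => h (j * m / n)
  have hg : Monotone g := fun a b hab =>
    hmono.monotone (Int.ediv_le_ediv hn' (mul_le_mul_of_nonneg_right hab S.pos.le))
  have hgn : ∀ j q : ℤ, g (j + n * q) = g j + q * T := by
    have h1 : ∀ j, g (j + n) = g j + T := fun j => by
      simp only [g]
      rw [add_mul, Int.add_mul_ediv_left _ _ hn'.ne', hh]
    intro j q
    induction q using Int.induction_on with
    | zero => simp
    | succ q ih =>
      rw [show j + n * ((q : ℤ) + 1) = j + n * q + n by ring, h1, ih]
      push_cast; ring
    | pred q ih =>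
      have := h1 (j + n * (-(q : ℤ) - 1))
      rw [show j + n * (-(q : ℤ) - 1) + n = j + n * -(q : ℤ) by ring, ih] at this
      push_cast at this ⊢
      linarith
  have hgk : ∀ j, g (j + k) ≤ h (j * m / n + s) := fun j => by
    refine hmono.monotone ?_
    rw [← Int.add_mul_ediv_right _ _ hn'.ne']
    exact Int.ediv_le_ediv hn' (by linarith)
  have hkn' : (k : ℤ) ≤ n := by
    by_contra! hlt
    nlinarith
  refine ⟨fun j => g j, fun j => g (j + k), fun j a b h1 h2 h3 =>
    hcut (j * m / n) a b h1 h2 (h3.trans (hgk j)), fun t => ?_⟩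
  obtain ⟨j, hj1, hj2⟩ : ∃ j, g j ≤ t ∧ t < g (j + 1) := by
    have h1 : ∀ q : ℤ, g (n * q) = g 0 + q * T := fun q => by simpa using hgn 0 q
    have h2 := Int.floor_le ((t - g 0) / T)
    have h3 := Int.lt_floor_add_one ((t - g 0) / T)
    rw [le_div_iff₀ S.period_pos] at h2
    rw [div_lt_iff₀ S.period_pos] at h3
    set q := ⌊(t - g 0) / T⌋
    have h4 : t < g (n * (q + 1)) := by rw [h1]; push_cast; linarith
    obtain ⟨j, hj, hmax⟩ := Int.exists_greatest_of_bdd (P := fun j => g j ≤ t)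
      ⟨n * (q + 1), fun j hj => by
        by_contra! hlt
        exact (h4.trans_le (hg hlt.le)).not_ge hj⟩ ⟨n * q, by rw [h1]; linarith⟩
    exact ⟨j, hj, not_le.1 fun h => by have := hmax _ h; omega⟩
  have hmod : ∀ r : ℕ, (j - r) % n < n := fun r => Int.emod_lt_of_pos _ hn'
  have hmod' : ∀ r : ℕ, 0 ≤ (j - r) % n := fun r => Int.emod_nonneg _ hn'.ne'
  -- A point in `[g j, g (j + 1))` lies in the arcs starting at `j, j - 1, …, j - k + 1`, which are
  -- distinct modulo `n` since `k ≤ n`.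
  let f : Fin k → Fin n := fun r => ⟨((j - (r : ℕ)) % n).toNat, by
    have := hmod r
    have := hmod' r
    omega⟩
  have hf : Function.Injective f := fun r r' hrr => by
    have h1 : ((j - (r : ℕ)) % n).toNat = ((j - (r' : ℕ)) % n).toNat := congrArg Fin.val hrr
    have h2 : (j - (r : ℕ)) % n = (j - (r' : ℕ)) % n := by
      have := hmod' r
      have := hmod' r'
      omega
    have h3 : (n : ℤ) ∣ (j - (r' : ℕ)) - (j - (r : ℕ)) := Int.ModEq.dvd h2
    have h4 := Int.eq_zero_of_abs_lt_dvd h3 (by rw [abs_lt]; omega)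
    exact Fin.ext (by omega)
  have hsub : Set.range f ⊆
      {j | ∃ r : ℤ, g j ≤ t + r * T ∧ t + r * T ≤ g (j + k)} := by
    rintro _ ⟨r, rfl⟩
    have hq := Int.emod_add_mul_ediv (j - (r : ℕ)) n
    have hf' : ((f r : ℕ) : ℤ) = j - (r : ℕ) + n * -((j - (r : ℕ)) / n) := by
      simp only [f]
      rw [Int.toNat_of_nonneg (hmod' r)]
      linear_combination hq
    have h1 : g (j - (r : ℕ)) ≤ g j := hg (by omega)
    have h2 : g (j + 1) ≤ g (j - (r : ℕ) + k) := hg (by omega)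
    refine ⟨-((j - (r : ℕ)) / n), ?_, ?_⟩
    · rw [hf', hgn]; linarith
    · rw [hf', add_right_comm, hgn]; linarith
  calc k = (Set.range f).ncard := by
        rw [← Set.image_univ, Set.ncard_image_of_injective _ hf, Set.ncard_univ, Nat.card_fin]
    _ ≤ _ := Set.ncard_le_ncard hsub (Set.toFinite _)

/-- A set of centers without diametral pairs has at most `s` elements. -/
theorem card_le_of_independent {N s : ℕ} [NeZero N] (hN : N = 2 * s + 1)
    (A : Finset (ZMod N)) (hA : ∀ i ∈ A, i + (s + 1 : ℕ) ∉ A) : A.card ≤ s := by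
  have h1 : Disjoint A (A.map (addRightEmbedding ((s + 1 : ℕ) : ZMod N))) := by
    rw [Finset.disjoint_left]
    intro i hi hi'
    obtain ⟨j, hj, rfl⟩ := Finset.mem_map.1 hi'
    exact hA j hj hi
  have h2 := Finset.card_le_univ (A ∪ A.map (addRightEmbedding ((s + 1 : ℕ) : ZMod N)))
  rw [Finset.card_union_of_disjoint h1, Finset.card_map, ZMod.card] at h2
  omega

theorem rel_val_add {N s : ℕ} [NeZero N] (S : DiametralSystem T (N : ℤ) D v)
    (harc : ∀ i t, v i ≤ t → t ≤ v (i + 1) → D t (v (i + s + 1))) (i : ZMod N) :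
    D (v i.val) (v (i + (s + 1 : ℕ)).val) := by
  refine S.center_of_dvd (harc i.val (v i.val) le_rfl (S.strictMono (by omega)).le) ?_
  rw [← ZMod.intCast_eq_intCast_iff_dvd_sub]
  simp [add_assoc]

end DiametralSystem

/-! ### Angular parametrisation of the boundary of a planar convex body -/

namespace ConvexCurve

/-- The signed area of the parallelogram spanned by two complex numbers. -/
def cross (z w : ℂ) : ℝ := z.re * w.im - z.im * w.re

variable {E : Type*} [NormedAddCommGroup E] [NormedSpace ℝ E]

/-- The distance in direction `t` from the origin to the boundary of `K`, in linear coordinates. -/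
noncomputable def radius (L : ℂ ≃L[ℝ] E) (K : Set E) (t : ℝ) : ℝ :=
  (gauge K (L (Complex.exp (t * Complex.I))))⁻¹

/-- The boundary point of `K` in direction `t`, in linear coordinates. -/
noncomputable def coord (L : ℂ ≃L[ℝ] E) (K : Set E) (t : ℝ) : ℂ :=
  (radius L K t : ℂ) * Complex.exp (t * Complex.I)

/-- The parametrisation by angle of the boundary of a convex body around the origin. -/
noncomputable def curve (L : ℂ ≃L[ℝ] E) (K : Set E) (t : ℝ) : E := L (coord L K t)

variable {L : ℂ ≃L[ℝ] E} {K : Set E}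

theorem curve_eq_smul (t : ℝ) :
    curve L K t = radius L K t • L (Complex.exp (t * Complex.I)) := by
  rw [curve, coord, ← map_smul, Complex.real_smul]

theorem curve_add_two_pi (t : ℝ) : curve L K (t + 2 * Real.pi) = curve L K t := by
  have : Complex.exp ((t + 2 * Real.pi : ℝ) * Complex.I) = Complex.exp (t * Complex.I) := by
    push_cast
    rw [add_mul, Complex.exp_add, Complex.exp_two_pi_mul_I, mul_one]
  simp only [curve, coord, radius, this]

theorem coord_add_two_pi (t : ℝ) : coord L K (t + 2 * Real.pi) = coord L K t :=
  L.injective (curve_add_two_pi t)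

theorem coord_re (t : ℝ) : (coord L K t).re = radius L K t * Real.cos t := by
  simp [coord, Complex.exp_ofReal_mul_I_re]

theorem coord_im (t : ℝ) : (coord L K t).im = radius L K t * Real.sin t := by
  simp [coord, Complex.exp_ofReal_mul_I_im]

theorem cross_coord (s t : ℝ) :
    cross (coord L K s) (coord L K t) = radius L K s * radius L K t * Real.sin (t - s) := by
  rw [cross, coord_re, coord_re, coord_im, coord_im, Real.sin_sub]; ring

section Body

variable (hconv : Convex ℝ K) (hnhds : K ∈ nhds 0) (hbdd : Bornology.IsBounded K)

include hnhds hbdd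

theorem gauge_exp_pos (t : ℝ) : 0 < gauge K (L (Complex.exp (t * Complex.I))) := by
  rw [gauge_pos (absorbent_nhds_zero hnhds) (NormedSpace.isVonNBounded_of_isBounded ℝ hbdd)]
  simp [Complex.exp_ne_zero]

theorem radius_pos (t : ℝ) : 0 < radius L K t := inv_pos.2 (gauge_exp_pos hnhds hbdd t)

theorem gauge_curve (t : ℝ) : gauge K (curve L K t) = 1 := by
  rw [curve_eq_smul, gauge_smul_of_nonneg (radius_pos hnhds hbdd t).le, smul_eq_mul]
  exact inv_mul_cancel₀ (gauge_exp_pos hnhds hbdd t).ne'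

omit hnhds hbdd in
theorem exists_curve_eq {x : E} (hx : gauge K x = 1) : ∃ t, curve L K t = x := by
  have hz := Complex.norm_mul_exp_arg_mul_I (L.symm x)
  have hx' : x = ‖L.symm x‖ • L (Complex.exp ((L.symm x).arg * Complex.I)) := by
    rw [← map_smul, Complex.real_smul, hz, L.apply_symm_apply]
  refine ⟨(L.symm x).arg, ?_⟩
  rw [curve_eq_smul, radius]
  conv_rhs => rw [hx']
  congr 1
  rw [hx', gauge_smul_of_nonneg (norm_nonneg _), smul_eq_mul] at hx
  exact (eq_inv_of_mul_eq_one_left hx).symm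

theorem curve_ne {s t : ℝ} (h1 : s < t) (h2 : t < s + 2 * Real.pi) :
    curve L K s ≠ curve L K t := by
  intro h
  have h3 : coord L K s = coord L K t := L.injective h
  have hs := radius_pos (L := L) hnhds hbdd s
  have ht := radius_pos (L := L) hnhds hbdd t
  have h4 : radius L K s = radius L K t := by
    have := congrArg norm h3
    simpa [coord, Complex.norm_exp_ofReal_mul_I, abs_of_pos hs, abs_of_pos ht] using this
  rw [coord, coord, h4] at h3
  have h5 := mul_left_cancel₀ (by exact_mod_cast ht.ne') h3
  rw [Complex.exp_eq_exp_iff_exists_int] at h5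
  obtain ⟨n, hn⟩ := h5
  have h6 : s = t + n * (2 * Real.pi) := by
    have h7 : (s : ℂ) * Complex.I = ((t + n * (2 * Real.pi) : ℝ) : ℂ) * Complex.I := by
      rw [hn]; push_cast; ring
    exact_mod_cast mul_right_cancel₀ Complex.I_ne_zero h7
  have hpi := Real.pi_pos
  have h7 : (n : ℝ) < 0 := by by_contra! h; nlinarith
  have h8 : (-1 : ℝ) < n := by by_contra! h; nlinarith
  have h9 : n < 0 := by exact_mod_cast h7
  have h10 : -1 < n := by exact_mod_cast h8
  omega

/-- Antipodal directions. -/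
theorem exists_curve_add_pi (t : ℝ) :
    ∃ r : ℝ, 0 < r ∧ curve L K (t + Real.pi) = -(r • curve L K t) := by
  have : Complex.exp ((t + Real.pi : ℝ) * Complex.I) = -Complex.exp (t * Complex.I) := by
    push_cast
    rw [add_mul, Complex.exp_add, Complex.exp_pi_mul_I]; ring
  have h := radius_pos (L := L) hnhds hbdd t
  refine ⟨radius L K (t + Real.pi) / radius L K t,
    div_pos (radius_pos hnhds hbdd _) h, ?_⟩
  rw [curve_eq_smul, this, curve_eq_smul, smul_smul, div_mul_cancel₀ _ h.ne', map_neg, smul_neg]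

include hconv

theorem continuous_curve : Continuous (curve L K) := by
  have h1 : Continuous fun t : ℝ => L (Complex.exp (t * Complex.I)) := by fun_prop
  have h2 : Continuous (radius L K) :=
    ((continuous_gauge hconv hnhds).comp h1).inv₀ fun t => (gauge_exp_pos hnhds hbdd t).ne'
  have : curve L K = fun t => radius L K t • L (Complex.exp (t * Complex.I)) :=
    funext curve_eq_smul
  rw [this]
  exact h2.smul h1

/-- The coefficients come from the sine rule. All three points have gauge one, so subadditivity of
the gauge gives `1 ≤ a + b`. -/
theorem exists_cone {s p t : ℝ} (h1 : s ≤ p) (h2 : p ≤ t) (h3 : s < t) (h4 : t < s + Real.pi) :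
    ∃ a b : ℝ, 0 ≤ a ∧ 0 ≤ b ∧ 1 ≤ a + b ∧ coord L K p = a * coord L K s + b * coord L K t := by
  have hs := radius_pos (L := L) hnhds hbdd s
  have hp := radius_pos (L := L) hnhds hbdd p
  have ht := radius_pos (L := L) hnhds hbdd t
  have hsin : 0 < Real.sin (t - s) := Real.sin_pos_of_pos_of_lt_pi (by linarith) (by linarith)
  have hsin1 : 0 ≤ Real.sin (t - p) :=
    Real.sin_nonneg_of_nonneg_of_le_pi (by linarith) (by linarith)
  have hsin2 : 0 ≤ Real.sin (p - s) :=
    Real.sin_nonneg_of_nonneg_of_le_pi (by linarith) (by linarith)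
  set a := radius L K p * Real.sin (t - p) / (radius L K s * Real.sin (t - s)) with ha
  set b := radius L K p * Real.sin (p - s) / (radius L K t * Real.sin (t - s)) with hb
  have ha0 : 0 ≤ a := by positivity
  have hb0 : 0 ≤ b := by positivity
  have ha' : a * radius L K s = radius L K p * Real.sin (t - p) / Real.sin (t - s) := by
    rw [ha]; field_simp
  have hb' : b * radius L K t = radius L K p * Real.sin (p - s) / Real.sin (t - s) := by
    rw [hb]; field_simp
  have heq : coord L K p = a * coord L K s + b * coord L K t := by
    have key : ∀ f : ℝ → ℝ, f p * Real.sin (t - s) =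
        Real.sin (t - p) * f s + Real.sin (p - s) * f t →
        radius L K p * f p = a * (radius L K s * f s) + b * (radius L K t * f t) := by
      intro f hf
      rw [← mul_assoc, ← mul_assoc, ha', hb']
      field_simp
      linear_combination hf
    apply Complex.ext
    · simp only [Complex.add_re, Complex.re_ofReal_mul, coord_re]
      apply key
      simp only [Real.sin_sub]
      ring
    · simp only [Complex.add_im, Complex.im_ofReal_mul, coord_im]
      apply key
      simp only [Real.sin_sub]
      ring
  refine ⟨a, b, ha0, hb0, ?_, heq⟩
  have h5 : curve L K p = a • curve L K s + b • curve L K t := by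
    simp only [curve]
    rw [heq, map_add, ← Complex.real_smul, ← Complex.real_smul, map_smul, map_smul]
  have h6 := gauge_add_le hconv (absorbent_nhds_zero hnhds) (a • curve L K s) (b • curve L K t)
  rw [← h5, gauge_smul_of_nonneg ha0, gauge_smul_of_nonneg hb0, gauge_curve hnhds hbdd,
    gauge_curve hnhds hbdd, gauge_curve hnhds hbdd] at h6
  simpa using h6

theorem exists_cone' {s p t : ℝ} (h1 : s ≤ p) (h2 : p ≤ t) (h3 : s < t) (h4 : t < s + Real.pi) :
    ∃ a b : ℝ, 0 ≤ a ∧ 0 ≤ b ∧ 1 ≤ a + b ∧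
      curve L K p = a • curve L K s + b • curve L K t := by
  obtain ⟨a, b, ha, hb, hab, h⟩ := exists_cone (L := L) hconv hnhds hbdd h1 h2 h3 h4
  refine ⟨a, b, ha, hb, hab, ?_⟩
  simp only [curve]
  rw [h, map_add, ← Complex.real_smul, ← Complex.real_smul, map_smul, map_smul]

/-- The signed area of an inscribed triangle. -/
def orient (z w u : ℂ) : ℝ := cross z w + cross w u + cross u z

omit hconv hnhds hbdd in
theorem orient_of_cone {a b : ℝ} {z w u : ℂ} (h : w = a * z + b * u) :
    orient z w u = (a + b - 1) * cross z u := by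
  simp only [orient, cross, h, Complex.add_re, Complex.add_im, Complex.re_ofReal_mul,
    Complex.im_ofReal_mul]
  ring

theorem orient_nonneg_of_lt_pi {s p t : ℝ} (h1 : s < p) (h2 : p < t) (h4 : t < s + Real.pi) :
    0 ≤ orient (coord L K s) (coord L K p) (coord L K t) := by
  obtain ⟨a, b, ha, hb, hab, h⟩ :=
    exists_cone (L := L) hconv hnhds hbdd h1.le h2.le (h1.trans h2) h4
  rw [orient_of_cone h, cross_coord]
  have := radius_pos (L := L) hnhds hbdd s
  have := radius_pos (L := L) hnhds hbdd t
  have := Real.sin_pos_of_pos_of_lt_pi (x := t - s) (by linarith) (by linarith)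
  exact mul_nonneg (by linarith) (by positivity)

/-- If one of the three angular gaps exceeds `π`, the vertices, cyclically permuted, fit in less
than a half turn; otherwise all three cross products are nonnegative. -/
theorem orient_nonneg {s p t : ℝ} (h1 : s < p) (h2 : p < t) (h4 : t < s + 2 * Real.pi) :
    0 ≤ orient (coord L K s) (coord L K p) (coord L K t) := by
  have hc := coord_add_two_pi (L := L) (K := K)
  rcases lt_or_ge t (s + Real.pi) with h | h
  · exact orient_nonneg_of_lt_pi hconv hnhds hbdd h1 h2 h
  rcases lt_or_ge (p + Real.pi) t with h' | h'
  · have := orient_nonneg_of_lt_pi (L := L) hconv hnhds hbdd (s := t) (p := s + 2 * Real.pi)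
      (t := p + 2 * Real.pi) h4 (by linarith) (by linarith)
    rw [hc, hc] at this
    simp only [orient] at this ⊢; linarith
  rcases lt_or_ge (s + Real.pi) p with h'' | h''
  · have := orient_nonneg_of_lt_pi (L := L) hconv hnhds hbdd (s := p) (p := t)
      (t := s + 2 * Real.pi) h2 h4 (by linarith)
    rw [hc] at this
    simp only [orient] at this ⊢; linarith
  have hs := radius_pos (L := L) hnhds hbdd s
  have hp := radius_pos (L := L) hnhds hbdd p
  have ht := radius_pos (L := L) hnhds hbdd t
  have i1 : 0 ≤ Real.sin (p - s) := Real.sin_nonneg_of_nonneg_of_le_pi (by linarith) (by linarith)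
  have i2 : 0 ≤ Real.sin (t - p) := Real.sin_nonneg_of_nonneg_of_le_pi (by linarith) (by linarith)
  have i3 : 0 ≤ Real.sin (s - t) := by
    rw [← Real.sin_add_two_pi]
    exact Real.sin_nonneg_of_nonneg_of_le_pi (by linarith) (by linarith)
  simp only [orient, cross_coord]
  positivity

/-- If the area of an inscribed triangle vanishes, its middle vertex is on the opposite side. -/
theorem mem_segment_of_orient_eq_zero {s p t : ℝ} (h1 : s < p) (h2 : p < t)
    (h4 : t < s + Real.pi) (h : orient (coord L K s) (coord L K p) (coord L K t) = 0) :
    curve L K p ∈ segment ℝ (curve L K s) (curve L K t) := by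
  obtain ⟨a, b, ha, hb, hab, h5⟩ :=
    exists_cone (L := L) hconv hnhds hbdd h1.le h2.le (h1.trans h2) h4
  rw [orient_of_cone h5, cross_coord] at h
  have hs := radius_pos (L := L) hnhds hbdd s
  have ht := radius_pos (L := L) hnhds hbdd t
  have hsin := Real.sin_pos_of_pos_of_lt_pi (x := t - s) (by linarith) (by linarith)
  have h6 : a + b - 1 = 0 := (mul_eq_zero.1 h).resolve_right (by positivity)
  refine ⟨a, b, ha, hb, by linarith, ?_⟩
  simp only [curve]
  rw [h5, map_add, ← Complex.real_smul, ← Complex.real_smul, map_smul, map_smul]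

/-- The diagonals of an inscribed quadrilateral intersect. -/
theorem exists_mem_segment_inter {t₁ t₂ t₃ t₄ : ℝ} (h1 : t₁ < t₂) (h2 : t₂ < t₃) (h3 : t₃ < t₄)
    (h4 : t₄ < t₁ + 2 * Real.pi) :
    ∃ o, o ∈ segment ℝ (curve L K t₁) (curve L K t₃) ∧
      o ∈ segment ℝ (curve L K t₂) (curve L K t₄) := by
  have hP := orient_nonneg (L := L) hconv hnhds hbdd h1 h2 (by linarith)
  have hQ := orient_nonneg (L := L) hconv hnhds hbdd (h1.trans h2) h3 h4
  have hR := orient_nonneg (L := L) hconv hnhds hbdd h2 h3 (by linarith)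
  have hS := orient_nonneg (L := L) hconv hnhds hbdd h1 (h2.trans h3) h4
  set z₁ := coord L K t₁ with hz1
  set z₂ := coord L K t₂ with hz2
  set z₃ := coord L K t₃ with hz3
  set z₄ := coord L K t₄ with hz4
  have hA : orient z₁ z₂ z₃ + orient z₁ z₃ z₄ = orient z₂ z₃ z₄ + orient z₁ z₂ z₄ := by
    simp only [orient, cross]; ring
  rcases (add_nonneg hP hQ).eq_or_lt with h0 | h0
  · have hP0 : orient z₁ z₂ z₃ = 0 := by linarith
    have hQ0 : orient z₁ z₃ z₄ = 0 := by linarith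
    rcases lt_trichotomy t₃ (t₁ + Real.pi) with h5 | h5 | h5
    · exact ⟨_, mem_segment_of_orient_eq_zero hconv hnhds hbdd h1 h2 h5 hP0,
        left_mem_segment _ _ _⟩
    · exfalso
      have i1 := radius_pos (L := L) hnhds hbdd t₁
      have i2 := radius_pos (L := L) hnhds hbdd t₂
      have i3 := radius_pos (L := L) hnhds hbdd t₃
      have i4 := Real.sin_pos_of_pos_of_lt_pi (x := t₂ - t₁) (by linarith) (by linarith)
      have i5 := Real.sin_pos_of_pos_of_lt_pi (x := t₃ - t₂) (by linarith) (by linarith)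
      have i6 : Real.sin (t₁ - t₃) = 0 := by
        rw [show t₁ - t₃ = -Real.pi by linarith]; simp
      simp only [orient, hz1, hz2, hz3, cross_coord, i6] at hP0
      have : 0 < radius L K t₁ * radius L K t₂ * Real.sin (t₂ - t₁) := by positivity
      have : 0 < radius L K t₂ * radius L K t₃ * Real.sin (t₃ - t₂) := by positivity
      linarith
    · have := mem_segment_of_orient_eq_zero (L := L) hconv hnhds hbdd h3 h4 (by linarith)
        (by rw [coord_add_two_pi]; rw [← hQ0]; simp only [orient]; ring)
      rw [curve_add_two_pi, segment_symm] at this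
      exact ⟨_, this, right_mem_segment _ _ _⟩
  · set A := orient z₁ z₂ z₃ + orient z₁ z₃ z₄ with hAdef
    -- After division by the area `A` of the quadrilateral, both sides are convex combinations: the
    -- intersection point of the diagonals.
    have hid : (orient z₁ z₃ z₄ : ℝ) • z₂ + (orient z₁ z₂ z₃) • z₄ =
        (orient z₂ z₃ z₄) • z₁ + (orient z₁ z₂ z₄) • z₃ := by
      apply Complex.ext <;> simp [orient, cross] <;> ring
    refine ⟨A⁻¹ • L (orient z₂ z₃ z₄ • z₁ + orient z₁ z₂ z₄ • z₃),
      ⟨A⁻¹ * orient z₂ z₃ z₄, A⁻¹ * orient z₁ z₂ z₄, by positivity, by positivity, ?_, ?_⟩,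
      ⟨A⁻¹ * orient z₁ z₃ z₄, A⁻¹ * orient z₁ z₂ z₃, by positivity, by positivity, ?_, ?_⟩⟩
    · rw [← mul_add, ← hA]; exact inv_mul_cancel₀ h0.ne'
    · simp only [curve, map_add, map_smul, smul_add, smul_smul, ← hz1, ← hz3]
    · rw [← mul_add, add_comm (orient _ _ _)]; exact inv_mul_cancel₀ h0.ne'
    · rw [← hid]
      simp only [curve, map_add, map_smul, smul_add, smul_smul, ← hz2, ← hz4]

/-- Between two points of a supporting line the curve runs on this line. -/
theorem eq_of_supporting {φ : E →L[ℝ] ℝ} {μ a a' x : ℝ} (h1 : a < a') (h2 : a' < x)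
    (h3 : x < a + 2 * Real.pi) (ha : φ (curve L K a) = μ) (ha' : φ (curve L K a') = μ)
    (hK : ∀ t, μ ≤ φ (curve L K t)) (hx : μ < φ (curve L K x)) {p : ℝ} (hp : a ≤ p)
    (hp' : p ≤ a') : φ (curve L K p) = μ := by
  -- If `μ ≥ 0`, then `φ` is positive at `x`, hence negative at the antipodal point and below its
  -- minimum.
  have hμ : μ < 0 := by
    by_contra! hμ
    obtain ⟨r, hr, h⟩ := exists_curve_add_pi (L := L) hnhds hbdd x
    have h4 := hK (x + Real.pi)
    rw [h, map_neg, map_smul, smul_eq_mul] at h4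
    nlinarith
  -- On an arc longer than `π`, the complementary arc through `x` would lie in a cone where `1 ≤ a +
  -- b` and `μ < 0` force `φ ≤ μ`.
  have hlt : a' < a + Real.pi := by
    by_contra! hle
    rcases hle.eq_or_lt with h4 | h4
    · obtain ⟨r, hr, h⟩ := exists_curve_add_pi (L := L) hnhds hbdd a
      rw [h4] at h
      rw [h, map_neg, map_smul, smul_eq_mul, ha] at ha'
      nlinarith
    · obtain ⟨u, w, hu, hw, huw, h⟩ := exists_cone' (L := L) hconv hnhds hbdd h2.le h3.le
        (h2.trans h3) (by linarith)
      rw [h, curve_add_two_pi, map_add, map_smul, map_smul, ha, ha', smul_eq_mul,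
        smul_eq_mul] at hx
      nlinarith
  obtain ⟨u, w, hu, hw, huw, h⟩ := exists_cone' (L := L) hconv hnhds hbdd hp hp' h1 hlt
  refine le_antisymm ?_ (hK p)
  rw [h, map_add, map_smul, map_smul, ha, ha', smul_eq_mul, smul_eq_mul]
  nlinarith

end Body

end ConvexCurve

/-! ### Diameters and parallel supporting lines -/

namespace ConvexCurve

variable {E : Type*} [NormedAddCommGroup E] [NormedSpace ℝ E] {L : ℂ ≃L[ℝ] E} {K : Set E}

section Body

variable (hconv : Convex ℝ K) (hnhds : K ∈ nhds 0) (hbdd : Bornology.IsBounded K)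
  (hdiam : ∀ s t, ‖curve L K s - curve L K t‖ ≤ 1)

theorem norm_eq_one_of_functional (hdiam : ∀ s t, ‖curve L K s - curve L K t‖ ≤ 1)
    {φ : E →L[ℝ] ℝ} (hφ : ∀ x, φ x ≤ ‖x‖) {p q : ℝ}
    (h : φ (curve L K q) - φ (curve L K p) = 1) : ‖curve L K p - curve L K q‖ = 1 := by
  refine le_antisymm (hdiam p q) ?_
  rw [norm_sub_rev, ← h, ← map_sub]
  exact hφ _

include hconv hnhds hbdd hdiam

/-- Two disjoint diameters lie between two parallel supporting lines at distance one, and these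
lines contain the arcs of the curve between the ends of the diameters. -/
theorem exists_functional {a a' b b' : ℝ} (h1 : a < a') (h2 : a' < b) (h3 : b < b')
    (h4 : b' < a + 2 * Real.pi) (hD : ‖curve L K a - curve L K b'‖ = 1)
    (hD' : ‖curve L K a' - curve L K b‖ = 1) :
    ∃ φ : E →L[ℝ] ℝ, (∀ x, φ x ≤ ‖x‖) ∧ ∀ {p q}, a ≤ p → p ≤ a' → b ≤ q → q ≤ b' →
      φ (curve L K q) - φ (curve L K p) = 1 := by
  obtain ⟨o, ho1, ho2⟩ := exists_mem_segment_inter (L := L) hconv hnhds hbdd h1 h2 h3 h4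
  have hne1 : curve L K a ≠ curve L K a' := curve_ne hnhds hbdd h1 (by linarith)
  have hne2 : curve L K b ≠ curve L K b' := curve_ne hnhds hbdd h3 (by linarith)
  have hab := hdiam a b
  have hab' := hdiam a' b'
  have hall : ∀ s t, ‖curve L K s - curve L K t‖ ≤ 1 := hdiam
  obtain ⟨φ, hφ1, hφ2⟩ := exists_dual_vector'' ℝ (curve L K b' - curve L K a)
  have hφ : ∀ x, φ x ≤ ‖x‖ := fun x =>
    (le_abs_self _).trans ((φ.le_opNorm x).trans (mul_le_of_le_one_left (norm_nonneg _) hφ1))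
  -- Let `o` be the intersection of the diagonals. The sides sum to two and, by the triangle
  -- inequality through `o`, to at most the sum of the diagonals, itself at most two. So equality
  -- holds throughout: `φ` norms `o - A` and `B' - o`, hence both diagonals.
  have hend : φ (curve L K b') = φ (curve L K b) ∧ φ (curve L K a') = φ (curve L K a) ∧
      φ (curve L K b') - φ (curve L K a) = 1 := by
    rw [norm_sub_rev, hD] at hφ2
    simp only [map_sub, RCLike.ofReal_real_eq_id, id_eq] at hφ2
    have e1 := dist_add_dist_of_mem_segment ho1
    have e2 := dist_add_dist_of_mem_segment ho2
    have t1 := dist_triangle (curve L K a) o (curve L K b')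
    have t2 := dist_triangle (curve L K a') o (curve L K b)
    obtain ⟨c, d, hc, hd, hcd, rfl⟩ := ho1
    obtain ⟨c', d', hc', hd', hcd', ho⟩ := ho2
    generalize curve L K a = A at *
    generalize curve L K a' = A' at *
    generalize curve L K b = B at *
    generalize curve L K b' = B' at *
    set o := c • A + d • B with hodef
    have hAB := hab
    rw [← dist_eq_norm] at hD hD' hab hab'
    have n1 : φ (o - A) ≤ dist A o := by rw [dist_comm, dist_eq_norm]; exact hφ _
    have n2 : φ (B' - o) ≤ dist o B' := by rw [dist_comm, dist_eq_norm]; exact hφ _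
    rw [map_sub] at n1 n2
    have k1 : φ o - φ A = dist A o := by linarith
    have k2 : φ B' - φ o = dist o B' := by linarith
    have k3 : dist A B = 1 := by linarith
    have k4 : dist A' B' = 1 := by linarith
    have oA : φ o - φ A = d * (φ B - φ A) := by
      rw [hodef, map_add, map_smul, map_smul, smul_eq_mul, smul_eq_mul,
        show c = 1 - d by linarith]; ring
    have oB : φ B' - φ o = c' * (φ B' - φ A') := by
      rw [← ho, map_add, map_smul, map_smul, smul_eq_mul, smul_eq_mul,
        show d' = 1 - c' by linarith]; ring
    have dA : dist A o = d := by
      have : A - o = d • (A - B) := by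
        rw [hodef, show c = 1 - d by linarith]; module
      rw [dist_eq_norm, this, norm_smul, ← dist_eq_norm, k3, Real.norm_of_nonneg hd, mul_one]
    have dB : dist o B' = c' := by
      have : o - B' = c' • (A' - B') := by
        rw [← ho, show d' = 1 - c' by linarith]; module
      rw [dist_eq_norm, this, norm_smul, ← dist_eq_norm, k4, Real.norm_of_nonneg hc', mul_one]
    have hd0 : d ≠ 0 := fun h0 => by
      have q1 : dist A' o = 0 := by linarith
      have q2 : dist A o = 0 := by linarith
      exact hne1 ((dist_eq_zero.1 q2).trans (dist_eq_zero.1 q1).symm)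
    have hc0 : c' ≠ 0 := fun h0 => by
      have q1 : dist o B' = 0 := by linarith
      have q2 : dist o B = 0 := by linarith
      exact hne2 ((dist_eq_zero.1 q2).symm.trans (dist_eq_zero.1 q1))
    have f1 : φ B - φ A = 1 := by
      apply mul_left_cancel₀ hd0; linarith
    have f2 : φ B' - φ A' = 1 := by
      apply mul_left_cancel₀ hc0; linarith
    exact ⟨by linarith, by linarith, hφ2⟩
  obtain ⟨i1, i2, i3⟩ := hend
  have hrange : ∀ s t, φ (curve L K s) - φ (curve L K t) ≤ 1 := fun s t => by
    rw [← map_sub]; exact (hφ _).trans (hall s t)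
  refine ⟨φ, hφ, fun {p q} hp hp' hq hq' => ?_⟩
  have hbot := eq_of_supporting (L := L) hconv hnhds hbdd h1 h2 (by linarith) rfl i2
    (fun t => by linarith [hrange b' t]) (by linarith) hp hp'
  have htop := eq_of_supporting (L := L) (φ := -φ) hconv hnhds hbdd h3 h4 (by linarith) rfl
    (by simp [i1]) (fun t => by
      have := hrange t a
      simp only [neg_apply]; linarith)
    (by rw [curve_add_two_pi]; simp only [neg_apply]; linarith) hq hq'
  simp only [neg_apply] at htop
  linarith

/-- The functionals of the two pairs of diameters agree on `a₁ - a` (value zero) and on `b' - a`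
(value one), a basis of the plane. The common functional then norms the chord from `a₂` to `b₁`. -/
theorem exists_functional_unique (hdim : Module.finrank ℝ E = 2)
    {a a₁ a₂ b₁ b₂ b' : ℝ} (h1 : a < a₁) (h2 : a₁ < a₂) (h3 : a₂ < b₁) (h4 : b₁ < b₂)
    (h5 : b₂ < b') (h6 : b' < a + 2 * Real.pi) (hD : ‖curve L K a - curve L K b'‖ = 1)
    (hD₁ : ‖curve L K a₁ - curve L K b₁‖ = 1) (hD₂ : ‖curve L K a₂ - curve L K b₂‖ = 1) :
    ‖curve L K a₂ - curve L K b₁‖ = 1 := by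
  obtain ⟨φ, hφ, hφ'⟩ := exists_functional hconv hnhds hbdd hdiam h1 (h2.trans h3)
    (h4.trans h5) h6 hD hD₁
  obtain ⟨ψ, hψ, hψ'⟩ := exists_functional hconv hnhds hbdd hdiam (h1.trans h2) (h3.trans h4)
    h5 h6 hD hD₂
  have p1 := hφ' le_rfl h1.le (h4.trans h5).le le_rfl
  have p2 := hφ' h1.le le_rfl (h4.trans h5).le le_rfl
  have p3 := hφ' h1.le le_rfl le_rfl (h4.trans h5).le
  have q1 := hψ' le_rfl (h1.trans h2).le h5.le le_rfl
  have q2 := hψ' h1.le h2.le h5.le le_rfl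
  have q3 := hψ' (h1.trans h2).le le_rfl h5.le le_rfl
  have hne : curve L K a₁ - curve L K a ≠ 0 :=
    sub_ne_zero.2 (curve_ne hnhds hbdd h1 (by linarith)).symm
  have hli : LinearIndependent ℝ ![curve L K a₁ - curve L K a, curve L K b' - curve L K a] := by
    rw [LinearIndependent.pair_iff]
    intro r t hrt
    have := congrArg φ hrt
    simp only [map_add, map_smul, map_sub, smul_eq_mul, map_zero, p1] at this
    have ht : t = 0 := by
      rw [show φ (curve L K a₁) - φ (curve L K a) = 0 by linarith] at this; linarith
    subst ht
    simp only [zero_smul, add_zero, smul_eq_zero] at hrt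
    exact ⟨hrt.resolve_right hne, rfl⟩
  have hspan : φ = ψ := by
    let B := basisOfLinearIndependentOfCardEqFinrank hli (by simp [hdim])
    apply ContinuousLinearMap.coe_injective
    refine B.ext fun i => ?_
    fin_cases i <;> simp [B] <;> linarith
  subst hspan
  exact norm_eq_one_of_functional hdiam hφ (by linarith)

/-- Seen from `a'`, the points `b`, `b'`, `b''` span two adjacent segments of the unit sphere. These
must be collinear, so `φ` and `ψ` both vanish on their common direction and each rectangle extends
past `b'`. -/
theorem corner_of_not_angled (hE : ¬ NormedPlane.IsAngled E) {a a' a'' b b' b'' : ℝ}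
    (h1 : a < a') (h2 : a' < b) (h3 : b < b') (h4 : b' < a + 2 * Real.pi)
    (hD : ‖curve L K a - curve L K b'‖ = 1) (hD' : ‖curve L K a' - curve L K b‖ = 1)
    (h5 : a' < a'') (h6 : a'' < b') (h7 : b' < b'') (h8 : b'' < a' + 2 * Real.pi)
    (hE1 : ‖curve L K a' - curve L K b''‖ = 1) (hE2 : ‖curve L K a'' - curve L K b'‖ = 1) :
    ‖curve L K a - curve L K b''‖ = 1 ∧ ‖curve L K a'' - curve L K b‖ = 1 := by
  obtain ⟨φ, hφ, hφ'⟩ := exists_functional hconv hnhds hbdd hdiam h1 h2 h3 h4 hD hD'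
  obtain ⟨ψ, hψ, hψ'⟩ := exists_functional hconv hnhds hbdd hdiam h5 h6 h7 h8 hE1 hE2
  have p1 := hφ' h1.le le_rfl le_rfl h3.le
  have p2 := hφ' h1.le le_rfl h3.le le_rfl
  have p3 := hφ' le_rfl h1.le h3.le le_rfl
  have q1 := hψ' le_rfl h5.le le_rfl h7.le
  have q2 := hψ' le_rfl h5.le h7.le le_rfl
  have q3 := hψ' h5.le le_rfl le_rfl h7.le
  have hne1 : curve L K b ≠ curve L K b' := curve_ne hnhds hbdd h3 (by linarith)
  have hne2 : curve L K b' ≠ curve L K b'' := curve_ne hnhds hbdd h7 (by linarith)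
  have hseg : ∀ (χ : E →L[ℝ] ℝ), (∀ x, χ x ≤ ‖x‖) → ∀ s t,
      χ (curve L K s) - χ (curve L K a') = 1 → χ (curve L K t) - χ (curve L K a') = 1 →
      segment ℝ (curve L K s - curve L K a') (curve L K t - curve L K a') ⊆
        Metric.sphere (0 : E) 1 := by
    intro χ hχ s t hs ht x hx
    have hball : x ∈ Metric.closedBall (0 : E) 1 :=
      (convex_closedBall (0 : E) 1).segment_subset (by simpa using hdiam s a')
        (by simpa using hdiam t a') hx
    obtain ⟨c, d, -, -, hcd, rfl⟩ := hx
    have h9 := hχ (c • (curve L K s - curve L K a') + d • (curve L K t - curve L K a'))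
    rw [map_add, map_smul, map_smul, map_sub, map_sub, hs, ht, smul_eq_mul, smul_eq_mul,
      mul_one, mul_one, hcd] at h9
    rw [mem_sphere_zero_iff_norm]
    exact le_antisymm (by simpa using hball) h9
  have hcol : Collinear ℝ {curve L K b - curve L K a', curve L K b' - curve L K a',
      curve L K b'' - curve L K a'} := by
    by_contra hnot
    exact hE ⟨_, _, _, hnot, Set.union_subset (hseg φ hφ _ _ p1 p2) (hseg ψ hψ _ _ q1 q2)⟩
  obtain ⟨w, hw⟩ := (collinear_iff_of_mem (p₀ := curve L K b' - curve L K a') (by simp)).1 hcol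
  obtain ⟨r, hr⟩ := hw (curve L K b - curve L K a') (by simp)
  obtain ⟨t, ht⟩ := hw (curve L K b'' - curve L K a') (by simp)
  have hr' : curve L K b - curve L K b' = r • w := by
    rw [vadd_eq_add] at hr
    rw [← sub_eq_iff_eq_add] at hr
    rw [← hr]; abel
  have ht' : curve L K b'' - curve L K b' = t • w := by
    rw [vadd_eq_add] at ht
    rw [← sub_eq_iff_eq_add] at ht
    rw [← ht]; abel
  have hr0 : r ≠ 0 := fun h => hne1 (sub_eq_zero.1 (by rw [hr', h, zero_smul]))
  have ht0 : t ≠ 0 := fun h => hne2 (sub_eq_zero.1 (by rw [ht', h, zero_smul])).symm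
  have hφw : φ w = 0 := by
    have := congrArg φ hr'
    rw [map_sub, map_smul, smul_eq_mul] at this
    exact (mul_eq_zero.1 (by linarith : r * φ w = 0)).resolve_left hr0
  have hψw : ψ w = 0 := by
    have := congrArg ψ ht'
    rw [map_sub, map_smul, smul_eq_mul] at this
    exact (mul_eq_zero.1 (by linarith : t * ψ w = 0)).resolve_left ht0
  have e1 := congrArg φ ht'
  have e2 := congrArg ψ hr'
  rw [map_sub, map_smul, hφw, smul_zero] at e1
  rw [map_sub, map_smul, hψw, smul_zero] at e2
  exact ⟨norm_eq_one_of_functional hdiam hφ (by linarith),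
    norm_eq_one_of_functional hdiam hψ (by linarith)⟩

end Body

end ConvexCurve

/-! ### Periodic enumeration of the centers -/

namespace DiametralSystem

/-- The increasing enumeration of all translates of a finite set by multiples of a period. -/
theorem exists_periodic_enumeration {T : ℝ} {m : ℕ} (hm : 0 < m) (A : Finset ℝ)
    (hcard : A.card = m) (hA : ∀ a ∈ A, 0 ≤ a ∧ a < T) :
    ∃ v : ℤ → ℝ, StrictMono v ∧ (∀ i, v (i + m) = v i + T) ∧
      (∀ i, ∃ a ∈ A, ∃ k : ℤ, v i = a + k * T) ∧ ∀ a ∈ A, ∃ i, v i = a := by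
  have hm' : (0 : ℤ) < m := by exact_mod_cast hm
  have hlt : ∀ i : ℤ, (i % m).toNat < m := fun i => by
    have := Int.emod_nonneg i hm'.ne'
    have := Int.emod_lt_of_pos i hm'
    omega
  let f := A.orderEmbOfFin hcard
  have hf : ∀ r, f r ∈ A := A.orderEmbOfFin_mem hcard
  refine ⟨fun i => f ⟨(i % m).toNat, hlt i⟩ + (i / m : ℤ) * T, strictMono_int_of_lt_succ fun i => ?_,
    fun i => ?_, fun i => ⟨_, hf _, _, rfl⟩, fun a ha => ?_⟩
  · have h0 := Int.emod_nonneg i hm'.ne'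
    have h1 := Int.emod_lt_of_pos i hm'
    have h2 := Int.emod_add_mul_ediv i m
    by_cases h : i % m + 1 < m
    · obtain ⟨h3, h4⟩ := (Int.ediv_emod_unique (a := i + 1) (q := i / m) (r := i % m + 1) hm').2
        ⟨by linarith, by omega, h⟩
      simp only [h3, h4, add_lt_add_iff_right]
      refine f.strictMono ?_
      rw [Fin.mk_lt_mk]
      omega
    · obtain ⟨h3, h4⟩ := (Int.ediv_emod_unique (a := i + 1) (q := i / m + 1) (r := 0) hm').2
        ⟨by rw [mul_add]; omega, le_rfl, hm'⟩
      simp only [h3, h4]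
      push_cast
      have h5 := (hA _ (hf ⟨(i % m).toNat, hlt i⟩)).2
      have h6 := (hA _ (hf ⟨0, hm⟩)).1
      linarith
  · simp only [Int.add_emod_right]
    rw [Int.add_ediv_of_dvd_right (dvd_refl _), Int.ediv_self hm'.ne']
    push_cast; ring
  · obtain ⟨r, hr⟩ : a ∈ Set.range f := by rw [Finset.range_orderEmbOfFin]; exact ha
    refine ⟨(r : ℕ), ?_⟩
    have h1 : ((r : ℕ) : ℤ) % m = (r : ℕ) := Int.emod_eq_of_lt (by omega) (by exact_mod_cast r.2)
    have h2 : ((r : ℕ) : ℤ) / m = 0 := Int.ediv_eq_zero_of_lt (by omega) (by exact_mod_cast r.2)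
    simp [h1, h2, hr]

end DiametralSystem

/-! ### The diametral system of a Reuleaux polygon -/

namespace ReuleauxPolygon

open ConvexCurve

variable {E : Type*} [NormedAddCommGroup E] [NormedSpace ℝ E] {C : Set E} {V : Finset E}

omit [NormedSpace ℝ E] in
theorem norm_sub_le_one (hC : NormedPlane.IsDiamComplete C) (hdiam : Metric.diam C = 1) {x y : E}
    (hx : x ∈ C) (hy : y ∈ C) : ‖x - y‖ ≤ 1 := by
  rw [← dist_eq_norm, ← hdiam]
  exact Metric.dist_le_diam_of_mem hC.1 hx hy

omit [NormedSpace ℝ E] in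
theorem mem_iff (hV : C = ⋂ x ∈ V, Metric.closedBall x 1) {x : E} :
    x ∈ C ↔ ∀ v ∈ V, ‖x - v‖ ≤ 1 := by
  simp [hV, dist_eq_norm]

omit [NormedSpace ℝ E] in
-- Since `C` lies in the unit ball around `v`, adding `v` does not increase the diameter, and
-- completeness applies.
theorem center_mem (hC : NormedPlane.IsDiamComplete C) (hdiam : Metric.diam C = 1)
    (hV : C = ⋂ x ∈ V, Metric.closedBall x 1) {v : E} (hv : v ∈ V) : v ∈ C := by
  by_contra hvC
  have hb : Bornology.IsBounded (insert v C) := hC.1.insert v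
  refine hC.2 (insert v C) hb (le_antisymm ?_ (Metric.diam_mono (Set.subset_insert _ _) hb))
    (Set.ssubset_insert hvC)
  have hd : ∀ x ∈ C, dist x v ≤ 1 := fun x hx => by
    rw [dist_eq_norm]; exact (mem_iff hV).1 hx v hv
  rw [hdiam]
  refine Metric.diam_le_of_forall_dist_le zero_le_one ?_
  rintro x (rfl | hx) y (rfl | hy)
  · simp
  · rw [dist_comm]; exact hd y hy
  · exact hd x hx
  · rw [dist_eq_norm]; exact norm_sub_le_one hC hdiam hx hy

theorem centers_nonempty [Nontrivial E] (hC : NormedPlane.IsDiamComplete C)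
    (hV : C = ⋂ x ∈ V, Metric.closedBall x 1) : V.Nonempty := by
  rw [Finset.nonempty_iff_ne_empty]
  rintro rfl
  have h := hC.1
  simp only [Finset.notMem_empty, Set.iInter_of_empty, Set.iInter_univ] at hV
  rw [hV] at h
  exact NormedSpace.unbounded_univ ℝ E h

/-- The barycenter of the centers is an interior point. -/
theorem exists_interior_point (hC : NormedPlane.IsDiamComplete C) (hdiam : Metric.diam C = 1)
    (hV : C = ⋂ x ∈ V, Metric.closedBall x 1) (hne : V.Nonempty) :
    ∃ c, ∀ v ∈ V, ‖c - v‖ < 1 := by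
  have hcard : (0 : ℝ) < V.card := by exact_mod_cast hne.card_pos
  refine ⟨(V.card : ℝ)⁻¹ • ∑ w ∈ V, w, fun v hv => ?_⟩
  have h1 : (V.card : ℝ)⁻¹ • ∑ w ∈ V, w - v = (V.card : ℝ)⁻¹ • ∑ w ∈ V, (w - v) := by
    rw [Finset.sum_sub_distrib, Finset.sum_const, smul_sub, ← Nat.cast_smul_eq_nsmul ℝ,
      smul_smul, inv_mul_cancel₀ hcard.ne', one_smul]
  -- Strict because the term `w = v` vanishes.
  have h2 : ‖∑ w ∈ V, (w - v)‖ < V.card := by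
    calc ‖∑ w ∈ V, (w - v)‖ ≤ ∑ w ∈ V, ‖w - v‖ := norm_sum_le _ _
      _ < ∑ w ∈ V, (1 : ℝ) := Finset.sum_lt_sum
          (fun w hw => norm_sub_le_one hC hdiam (center_mem hC hdiam hV hw)
            (center_mem hC hdiam hV hv)) ⟨v, hv, by simp⟩
      _ = V.card := by simp
  rw [h1, norm_smul, norm_inv, Real.norm_of_nonneg hcard.le, inv_mul_lt_iff₀ hcard, mul_one]
  exact h2

/-- In a shortest representation by balls, each ball has a boundary point that is interior to the
other balls. -/
theorem exists_essential_point (hV : C = ⋂ x ∈ V, Metric.closedBall x 1)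
    (hmin : ∀ n, NormedPlane.IsInterUnitBalls C n → V.card ≤ n) {c : E}
    (hc : ∀ v ∈ V, ‖c - v‖ < 1) {v : E} (hv : v ∈ V) :
    ∃ x ∈ C, ‖x - v‖ = 1 ∧ ∀ w ∈ V, w ≠ v → ‖x - w‖ < 1 := by
  classical
  -- By minimality the ball around `v` cannot be dropped. On the way from `c` to `y` the sphere
  -- around `v` is crossed strictly inside the other balls.
  obtain ⟨y, hy, hyv⟩ : ∃ y, (∀ w ∈ V, w ≠ v → ‖y - w‖ ≤ 1) ∧ 1 < ‖y - v‖ := by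
    by_contra! hcon
    have := hmin _ ⟨V.erase v, rfl, by
      ext x
      rw [mem_iff hV]
      simp only [Finset.mem_erase, Set.mem_iInter, Metric.mem_closedBall, dist_eq_norm]
      refine ⟨fun h w hw => h w hw.2, fun h w hw => ?_⟩
      by_cases hwv : w = v
      · exact hwv ▸ hcon x fun w hw hne => h w ⟨hne, hw⟩
      · exact h w ⟨hwv, hw⟩⟩
    rw [Finset.card_erase_of_mem hv] at this
    have := Finset.card_pos.2 ⟨v, hv⟩
    omega
  have hcont : ContinuousOn (fun t : ℝ => ‖(1 - t) • c + t • y - v‖) (Set.Icc 0 1) := by fun_prop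
  obtain ⟨t, ht, ht1⟩ := intermediate_value_Icc zero_le_one hcont
    (show (1 : ℝ) ∈ Set.Icc _ _ by
      simp only [sub_zero, one_smul, zero_smul, add_zero, sub_self, zero_add]
      exact ⟨(hc v hv).le, hyv.le⟩)
  simp only at ht1
  have ht' : t < 1 := lt_of_le_of_ne ht.2 fun h => by
    rw [h] at ht1
    simp only [sub_self, zero_smul, one_smul, zero_add] at ht1
    linarith
  have hlt : ∀ w ∈ V, w ≠ v → ‖(1 - t) • c + t • y - w‖ < 1 := fun w hw hne => by
    have h1 : (1 - t) • c + t • y - w = (1 - t) • (c - w) + t • (y - w) := by module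
    calc ‖(1 - t) • c + t • y - w‖ ≤ (1 - t) * ‖c - w‖ + t * ‖y - w‖ := by
          rw [h1]
          refine (norm_add_le _ _).trans (le_of_eq ?_)
          rw [norm_smul, norm_smul, Real.norm_of_nonneg ht.1, Real.norm_of_nonneg (by linarith)]
      _ < (1 - t) * 1 + t * 1 := add_lt_add_of_lt_of_le
          (mul_lt_mul_of_pos_left (hc w hw) (by linarith))
          (mul_le_mul_of_nonneg_left (hy w hw hne) ht.1)
      _ = 1 := by ring
  refine ⟨(1 - t) • c + t • y, (mem_iff hV).2 fun w hw => ?_, ht1, hlt⟩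
  by_cases hwv : w = v
  · exact hwv ▸ ht1.le
  · exact (hlt w hw hwv).le

/-- The boundary of a Reuleaux polygon and its centers form a diametral system. -/
theorem exists_diametralSystem (hdim : Module.finrank ℝ E = 2) (hE : ¬ NormedPlane.IsAngled E)
    (hC : NormedPlane.IsDiamComplete C) (hdiam : Metric.diam C = 1)
    (hV : C = ⋂ x ∈ V, Metric.closedBall x 1)
    (hmin : ∀ n, NormedPlane.IsInterUnitBalls C n → V.card ≤ n) :
    ∃ (T : ℝ) (γ : ℝ → E) (v : ℤ → ℝ),
      DiametralSystem T V.card (fun s t => ‖γ s - γ t‖ = 1) v ∧ Continuous γ ∧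
      (∀ t, γ (t + T) = γ t) ∧ (∀ t, γ t ∈ C) ∧
      ∀ x ∈ C, (∃ y ∈ C, ‖x - y‖ = 1) → ∃ t, γ t = x := by
  have : Nontrivial E := Module.nontrivial_of_finrank_pos (R := ℝ) (by omega)
  have : FiniteDimensional ℝ E := FiniteDimensional.of_finrank_pos (by omega)
  have hne := centers_nonempty hC hV
  obtain ⟨c, hc⟩ := exists_interior_point hC hdiam hV hne
  let L : ℂ ≃L[ℝ] E :=
    ContinuousLinearEquiv.ofFinrankEq (by rw [hdim, Complex.finrank_real_complex])
  let K : Set E := {x | x + c ∈ C}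
  have hconv : Convex ℝ K := by
    have : Convex ℝ C := by
      rw [hV]; exact convex_iInter₂ fun x _ => convex_closedBall x 1
    exact this.translate_preimage_left c
  have hclosed : IsClosed K := by
    have : IsClosed C := by
      rw [hV]; exact isClosed_biInter fun x _ => Metric.isClosed_closedBall
    exact this.preimage (by fun_prop)
  have hint : ∀ x, (∀ v ∈ V, ‖x + c - v‖ < 1) → K ∈ nhds x := fun x hx => by
    have : ∀ᶠ y in nhds x, ∀ v ∈ V, ‖y + c - v‖ < 1 := by
      rw [Filter.eventually_all_finset]
      intro v hv
      exact (show Continuous fun y => ‖y + c - v‖ by fun_prop).continuousAt.eventually_lt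
        continuousAt_const (hx v hv)
    exact this.mono fun y hy => (mem_iff hV).2 fun v hv => (hy v hv).le
  have hnhds : K ∈ nhds 0 := hint 0 fun v hv => by simpa using hc v hv
  have hbdd : Bornology.IsBounded K := by
    obtain ⟨R, hR⟩ := hC.1.exists_norm_le
    refine isBounded_iff_forall_norm_le.2 ⟨R + ‖c‖, fun x hx => ?_⟩
    have h1 := hR (x + c) hx
    have h2 := norm_sub_le (x + c) c
    rw [add_sub_cancel_right] at h2
    linarith
  have hmem : ∀ t, curve L K t + c ∈ C := fun t => by
    have := (gauge_le_one_iff_mem_closure hconv hnhds).1 (gauge_curve (L := L) hnhds hbdd t).le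
    rwa [hclosed.closure_eq] at this
  have hcover : ∀ t, ∃ v ∈ V, ‖curve L K t + c - v‖ = 1 := fun t => by
    by_contra! hcon
    have h1 := hint (curve L K t) fun v hv =>
      lt_of_le_of_ne ((mem_iff hV).1 (hmem t) v hv) (hcon v hv)
    have h2 := interior_subset_gauge_lt_one K (mem_interior_iff_mem_nhds.2 h1)
    simp [gauge_curve hnhds hbdd] at h2
  have hbdry : ∀ x ∈ C, (∃ y ∈ C, ‖x - y‖ = 1) → ∃ t, curve L K t + c = x := by
    rintro x hx ⟨y, hy, hxy⟩
    -- An end `x` of a diameter is on the boundary: an interior point could be pushed away from `y`,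
    -- to distance greater than one.
    have h1 : gauge K (x - c) = 1 := by
      refine le_antisymm (gauge_le_one_of_mem (by simpa [K] using hx)) ?_
      by_contra! hlt
      have h2 : K ∈ nhds (x - c) := by
        rw [← mem_interior_iff_mem_nhds, ← setOfPred_gauge_lt_one_eq_interior hconv hnhds]
        exact hlt
      have h3 : ∀ᶠ δ : ℝ in nhdsWithin 0 (Set.Ioi 0), x - c + δ • (x - y) ∈ K := by
        have : Filter.Tendsto (fun δ : ℝ => x - c + δ • (x - y)) (nhdsWithin 0 (Set.Ioi 0))
            (nhds (x - c)) := by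
          have : Continuous fun δ : ℝ => x - c + δ • (x - y) := by fun_prop
          have := (this.tendsto 0).mono_left (nhdsWithin_le_nhds (s := Set.Ioi 0))
          simpa using this
        exact this h2
      obtain ⟨δ, h4, h5⟩ := (h3.and self_mem_nhdsWithin).exists
      replace h5 : 0 < δ := h5
      have h6 : x - c + δ • (x - y) + c ∈ C := h4
      have h7 := norm_sub_le_one hC hdiam h6 hy
      rw [show x - c + δ • (x - y) + c - y = (1 + δ) • (x - y) by module, norm_smul, hxy,
        Real.norm_of_nonneg (by linarith)] at h7
      linarith
    obtain ⟨t, ht⟩ := exists_curve_eq (L := L) h1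
    exact ⟨t, by rw [ht, sub_add_cancel]⟩
  have hle : ∀ s t, ‖curve L K s - curve L K t‖ ≤ 1 := fun s t => by
    have := norm_sub_le_one hC hdiam (hmem s) (hmem t)
    rwa [add_sub_add_right_eq_sub] at this
  have hpi := Real.two_pi_pos
  have hmul : ∀ t (k : ℤ), curve L K (t + k * (2 * Real.pi)) = curve L K t := fun t k =>
    (show Function.Periodic (curve L K) (2 * Real.pi) from curve_add_two_pi).int_mul k t
  have hangle : ∀ w ∈ V, ∃ θ, 0 ≤ θ ∧ θ < 2 * Real.pi ∧ curve L K θ + c = w := fun w hw => by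
    obtain ⟨x, hx, hxw, -⟩ := exists_essential_point hV hmin hc hw
    obtain ⟨t, ht⟩ := hbdry w (center_mem hC hdiam hV hw) ⟨x, hx, by rw [norm_sub_rev]; exact hxw⟩
    have h1 := Int.floor_le (t / (2 * Real.pi))
    have h2 := Int.lt_floor_add_one (t / (2 * Real.pi))
    rw [le_div_iff₀ hpi] at h1
    rw [div_lt_iff₀ hpi] at h2
    refine ⟨t + (-⌊t / (2 * Real.pi)⌋ : ℤ) * (2 * Real.pi), by push_cast; linarith,
      by push_cast; linarith, by rw [hmul, ht]⟩
  choose! θ hθ0 hθ1 hθ using hangle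
  have hinj : Set.InjOn θ V := fun w hw w' hw' h => by rw [← hθ w hw, ← hθ w' hw', h]
  obtain ⟨v, hmono, hper, hv1, hv2⟩ := DiametralSystem.exists_periodic_enumeration hne.card_pos
    (V.image θ) (Finset.card_image_of_injOn hinj) (T := 2 * Real.pi) (by
      intro a ha
      obtain ⟨w, hw, rfl⟩ := Finset.mem_image.1 ha
      exact ⟨hθ0 w hw, hθ1 w hw⟩)
  have hvV : ∀ i, curve L K (v i) + c ∈ V := fun i => by
    obtain ⟨a, ha, k, hk⟩ := hv1 i
    obtain ⟨w, hw, rfl⟩ := Finset.mem_image.1 ha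
    rw [hk, hmul, hθ w hw]; exact hw
  have hVv : ∀ w ∈ V, ∃ i, curve L K (v i) + c = w := fun w hw => by
    obtain ⟨i, hi⟩ := hv2 (θ w) (Finset.mem_image_of_mem _ hw)
    exact ⟨i, by rw [hi, hθ w hw]⟩
  have hvinj : ∀ i j, curve L K (v j) = curve L K (v i) → (V.card : ℤ) ∣ j - i := by
    intro i j hij
    have h1 := Int.floor_le ((v j - v i) / (2 * Real.pi))
    have h2 := Int.lt_floor_add_one ((v j - v i) / (2 * Real.pi))
    rw [le_div_iff₀ hpi] at h1
    rw [div_lt_iff₀ hpi] at h2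
    set k := ⌊(v j - v i) / (2 * Real.pi)⌋
    have h3 : v j = v i + k * (2 * Real.pi) := by
      by_contra hne
      refine curve_ne (L := L) hnhds hbdd (s := v i) (t := v j + (-k : ℤ) * (2 * Real.pi)) ?_ ?_ ?_
      · refine lt_of_le_of_ne (by push_cast; linarith) fun h => hne ?_
        push_cast at h; linarith
      · push_cast; linarith
      · rw [hmul, hij]
    have h4 : ∀ k : ℤ, v (i + V.card * k) = v i + k * (2 * Real.pi) := fun k => by
      induction k using Int.induction_on with
      | zero => simp
      | succ k ih =>
        rw [show i + (V.card : ℤ) * ((k : ℤ) + 1) = i + V.card * k + V.card by ring, hper, ih]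
        push_cast; ring
      | pred k ih =>
        have := hper (i + V.card * (-(k : ℤ) - 1))
        rw [show i + (V.card : ℤ) * (-(k : ℤ) - 1) + V.card = i + V.card * -(k : ℤ) by ring,
          ih] at this
        push_cast at this ⊢
        linarith
    have h5 := hmono.injective (h3.trans (h4 k).symm)
    exact ⟨k, by omega⟩
  have hcont := continuous_curve (L := L) hconv hnhds hbdd
  refine ⟨2 * Real.pi, fun t => curve L K t + c, v, ?_, by fun_prop,
    fun t => by simp only [curve_add_two_pi], hmem, hbdry⟩
  simp only [add_sub_add_right_eq_sub]
  exact
    { period_pos := hpi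
      symm := fun h => by rwa [norm_sub_rev]
      add_period := fun h => by rwa [curve_add_two_pi]
      sub_period := fun {s t} h => by
        rwa [← curve_add_two_pi (t - 2 * Real.pi), sub_add_cancel]
      irrefl := fun t => by simp
      isClosed := isClosed_eq (by fun_prop) continuous_const
      rect := fun {a a' b b'} h1 h2 h3 h4 hD hD' {p q} hp hp' hq hq' => by
        obtain ⟨φ, hφ, hφ'⟩ := exists_functional hconv hnhds hbdd hle h1 h2 h3 h4 hD hD'
        exact norm_eq_one_of_functional hle hφ (hφ' hp hp' hq hq')
      corner := fun h1 h2 h3 h4 hD hD' h5 h6 h7 h8 hE1 hE2 =>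
        corner_of_not_angled hconv hnhds hbdd hle hE h1 h2 h3 h4 hD hD' h5 h6 h7 h8 hE1 hE2
      merge := fun h1 h2 h3 h4 h5 h6 hD hD₁ hD₂ =>
        exists_functional_unique hconv hnhds hbdd hle hdim h1 h2 h3 h4 h5 h6 hD hD₁ hD₂
      pos := by exact_mod_cast hne.card_pos
      strictMono := hmono
      equivariant := hper
      cover := fun t => by
        obtain ⟨w, hw, h⟩ := hcover t
        obtain ⟨i, rfl⟩ := hVv w hw
        exact ⟨i, by rwa [add_sub_add_right_eq_sub] at h⟩
      essential := fun i => by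
        obtain ⟨x, hx, hxv, hxw⟩ := exists_essential_point hV hmin hc (hvV i)
        obtain ⟨z, rfl⟩ := hbdry x hx ⟨_, center_mem hC hdiam hV (hvV i), hxv⟩
        refine ⟨z, by rwa [add_sub_add_right_eq_sub] at hxv, fun j hj => hvinj i j ?_⟩
        by_contra hne
        have := hxw _ (hvV j) fun h => hne (add_right_cancel h)
        rw [add_sub_add_right_eq_sub] at this
        linarith }

end ReuleauxPolygon

/-! ### From arcs to Borsuk coverings, and the counting bound -/

namespace ReuleauxPolygon

variable {E : Type*} [NormedAddCommGroup E]

theorem diam_lt_one_of_isCompact {A : Set E} (hA : IsCompact A)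
    (hle : ∀ x ∈ A, ∀ y ∈ A, dist x y ≤ 1) (hne : ∀ x ∈ A, ∀ y ∈ A, dist x y ≠ 1) :
    Metric.diam A < 1 := by
  rcases A.eq_empty_or_nonempty with rfl | hA'
  · simp
  obtain ⟨⟨a, b⟩, ⟨ha, hb⟩, hmax⟩ := (hA.prod hA).exists_isMaxOn (hA'.prod hA')
    (f := fun p => dist p.1 p.2) (by fun_prop)
  calc Metric.diam A ≤ dist a b :=
        Metric.diam_le_of_forall_dist_le dist_nonneg fun x hx y hy => hmax (Set.mk_mem_prod hx hy)
    _ < 1 := lt_of_le_of_ne (hle a ha b hb) (hne a ha b hb)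

/-- Compact sets without diametral pairs that cover all ends of diameters `k` times can be enlarged
to a `k`-fold Borsuk covering. -/
theorem exists_isBorsukCovering {C : Set E} (hC : IsCompact C) (hdiam : Metric.diam C = 1)
    {k n : ℕ} (Y : Fin n → Set E) (hYc : ∀ j, IsCompact (Y j)) (hYC : ∀ j, Y j ⊆ C)
    (hY : ∀ j, ∀ x ∈ Y j, ∀ y ∈ Y j, dist x y ≠ 1)
    (hcov : ∀ x ∈ C, (∃ y ∈ C, dist x y = 1) → k ≤ Set.ncard {j | x ∈ Y j}) :
    ∃ F : Fin n → Set E, NormedPlane.IsBorsukCovering k C F := by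
  have hle : ∀ x ∈ C, ∀ y ∈ C, dist x y ≤ 1 := fun x hx y hy =>
    hdiam ▸ Metric.dist_le_diam_of_mem hC.isBounded hx hy
  -- Points away from all ends of diameters will belong to all `n` sets, so this must suffice. A
  -- diameter is attained by compactness, and its ends are covered `k` times.
  have hkn : k ≤ n := by
    by_contra! hlt
    refine (diam_lt_one_of_isCompact hC hle fun x hx y hy hxy => ?_).ne hdiam
    have h1 := hcov x hx ⟨y, hy, hxy⟩
    have h2 := Set.ncard_le_ncard (Set.subset_univ {j | x ∈ Y j}) (Set.toFinite _)
    rw [Set.ncard_univ, Nat.card_fin] at h2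
    omega
  obtain ⟨ε, hε, hε0⟩ : ∃ ε : ℝ, (∀ j, Metric.diam (Y j) + 2 * ε < 1) ∧ 0 < ε := by
    have h : ∀ᶠ ε : ℝ in nhdsWithin 0 (Set.Ioi 0), ∀ j, Metric.diam (Y j) + 2 * ε < 1 := by
      rw [Filter.eventually_all]
      intro j
      have h1 := diam_lt_one_of_isCompact (hYc j)
        (fun x hx y hy => hle x (hYC j hx) y (hYC j hy)) (hY j)
      refine Filter.Eventually.filter_mono nhdsWithin_le_nhds ?_
      refine (show Continuous fun ε : ℝ => Metric.diam (Y j) + 2 * ε by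
        fun_prop).continuousAt.eventually_lt continuousAt_const ?_
      simpa using h1
    exact (h.and self_mem_nhdsWithin).exists
  -- The ends of diameters. Off a neighbourhood of `M` no point has a partner in `C`, so this part
  -- can be added to every member without creating a diametral pair.
  let M : Set E := {x | x ∈ C ∧ ∃ y ∈ C, dist x y = 1}
  refine ⟨fun j => C ∩ Metric.cthickening ε (Y j) ∪ C \ Metric.thickening ε M, fun j => ⟨?_, ?_⟩,
    fun x hx => ?_⟩
  · exact Set.union_subset Set.inter_subset_left Set.sdiff_subset
  · rw [hdiam]
    have hM : ∀ x ∈ C \ Metric.thickening ε M, ∀ y ∈ C, dist x y ≠ 1 := fun x hx y hy hxy =>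
      hx.2 (Metric.self_subset_thickening hε0 M ⟨hx.1, y, hy, hxy⟩)
    refine diam_lt_one_of_isCompact ((hC.inter_right Metric.isClosed_cthickening).union
      (hC.diff Metric.isOpen_thickening)) ?_ ?_
    · rintro x (hx | hx) y (hy | hy) <;> exact hle x hx.1 y hy.1
    · rintro x (hx | hx) y (hy | hy)
      · refine (lt_of_le_of_lt ?_ (hε j)).ne
        exact (Metric.dist_le_diam_of_mem (hYc j).isBounded.cthickening hx.2 hy.2).trans
          (Metric.diam_cthickening_le _ hε0.le)
      · rw [dist_comm]; exact hM y hy x hx.1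
      · exact hM x hx y hy.1
      · exact hM x hx y hy.1
  · by_cases hxM : x ∈ Metric.thickening ε M
    · obtain ⟨d, hd, hxd⟩ := Metric.mem_thickening_iff.1 hxM
      refine (hcov d hd.1 hd.2).trans (Set.ncard_le_ncard (fun j hj => ?_) (Set.toFinite _))
      exact Or.inl ⟨hx, Metric.mem_cthickening_of_dist_le x d ε _ hj hxd.le⟩
    · have : {j : Fin n | x ∈ C ∩ Metric.cthickening ε (Y j) ∪ C \ Metric.thickening ε M} =
          Set.univ := Set.eq_univ_of_forall fun j => Or.inr ⟨hx, hxM⟩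
      rw [this, Set.ncard_univ, Nat.card_fin]
      exact hkn

/-- Count pairs of a center and a member containing it: at least `k` for each of the `2 * s + 1`
centers, at most `s` for each member by `card_le_of_independent`. -/
theorem le_of_isBorsukCovering {C : Set E} (hdiam : Metric.diam C = 1) (hC : Bornology.IsBounded C)
    {s N : ℕ} [NeZero N] (hN : N = 2 * s + 1) (p : ZMod N → E) (hp : ∀ i, p i ∈ C)
    (hd : ∀ i, dist (p i) (p (i + (s + 1 : ℕ))) = 1) {k n : ℕ} {F : Fin n → Set E}
    (hF : NormedPlane.IsBorsukCovering k C F) : k * (2 * s + 1) ≤ s * n := by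
  classical
  have h1 : ∀ i, k ≤ (Finset.univ.filter fun j => p i ∈ F j).card := fun i => by
    have := hF.2 (p i) (hp i)
    rwa [Set.ncard_eq_toFinset_card', Set.toFinset_ofPred] at this
  have h2 : ∀ j, (Finset.univ.filter fun i => p i ∈ F j).card ≤ s := fun j => by
    refine DiametralSystem.card_le_of_independent hN _ fun i hi hi' => ?_
    simp only [Finset.mem_filter, Finset.mem_univ, true_and] at hi hi'
    have h3 := Metric.dist_le_diam_of_mem (hC.subset (hF.1 j).1) hi hi'
    rw [hd i, ← hdiam] at h3
    exact h3.not_gt (hF.1 j).2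
  calc k * (2 * s + 1) = ∑ _i : ZMod N, k := by simp [ZMod.card, hN, mul_comm]
    _ ≤ ∑ i : ZMod N, (Finset.univ.filter fun j => p i ∈ F j).card :=
        Finset.sum_le_sum fun i _ => h1 i
    _ = ∑ j : Fin n, (Finset.univ.filter fun i => p i ∈ F j).card :=
        Finset.sum_card_bipartiteAbove_eq_sum_card_bipartiteBelow _
    _ ≤ ∑ _j : Fin n, s := Finset.sum_le_sum fun j _ => h2 j
    _ = s * n := by simp [mul_comm]

/-- The left side says `k ≤ s * (n - 2 * k)`; divide by `s`. -/
theorem mul_le_iff_le {k s n : ℕ} (hs : 1 ≤ s) :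
    k * (2 * s + 1) ≤ s * n ↔ 2 * k + ⌈(k : ℚ) / (s : ℚ)⌉₊ ≤ n := by
  have hs' : (0 : ℚ) < s := by exact_mod_cast hs
  constructor
  · intro h
    have h2 : 2 * k ≤ n := by
      by_contra! hlt
      nlinarith
    have : ⌈(k : ℚ) / (s : ℚ)⌉₊ ≤ n - 2 * k := by
      rw [Nat.ceil_le, div_le_iff₀ hs', Nat.cast_sub h2]
      have : (k : ℚ) * (2 * s + 1) ≤ s * n := by exact_mod_cast h
      push_cast
      linarith
    omega
  · intro h
    have h1 := Nat.le_ceil ((k : ℚ) / (s : ℚ))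
    rw [div_le_iff₀ hs'] at h1
    have h2 : k ≤ ⌈(k : ℚ) / (s : ℚ)⌉₊ * s := by exact_mod_cast h1
    nlinarith

end ReuleauxPolygon

/-! ### The theorem -/

theorem mainTheorem1 {E : Type*} [NormedAddCommGroup E] [NormedSpace ℝ E]
    (hdim : Module.finrank ℝ E = 2) (hE : ¬ NormedPlane.IsAngled E)
    (C : Set E) (hC : NormedPlane.IsReuleauxPolygon C) (hdiam : Metric.diam C = 1)
    (m : ℕ) (hm : NormedPlane.HasSides C m) :
    Odd m ∧
      ∀ s : ℕ, m = 2 * s + 1 →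
        1 ≤ s ∧
          ∀ k : ℕ, NormedPlane.borsukNumber k C = ((2 * k + ⌈(k : ℚ) / (s : ℚ)⌉₊ : ℕ) : ℕ∞) := by
  obtain ⟨V, rfl, hV⟩ := hm.1
  obtain ⟨T, γ, v, S, hcont, hper, hmem, hbdry⟩ := ReuleauxPolygon.exists_diametralSystem hdim hE
    hC.1 hdiam hV fun n hn => hm.2 hn
  obtain ⟨s, hs, hms, hpriv, harc⟩ := S.exists_cyclic_structure
  refine ⟨(Int.odd_coe_nat _).1 ⟨s, hms⟩, fun s' hs' => ?_⟩
  obtain rfl : s = s' := by omega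
  have hs1 : 1 ≤ s' := by omega
  have : FiniteDimensional ℝ E := FiniteDimensional.of_finrank_pos (by omega)
  have : ProperSpace E := FiniteDimensional.proper ℝ E
  have hcomp : IsCompact C := by
    refine Metric.isCompact_of_isClosed_isBounded ?_ hC.1.1
    rw [hV]; exact isClosed_biInter fun x _ => Metric.isClosed_closedBall
  have : NeZero V.card := ⟨by omega⟩
  refine ⟨hs1, fun k => le_antisymm ?_ (le_iInf₂ ?_)⟩
  · refine iInf₂_le _ ?_
    set n := 2 * k + ⌈(k : ℚ) / (s' : ℚ)⌉₊ with hn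
    -- The evenly spaced arcs need `0 < n`; the value `n = 0` occurs only for `k = 0`, where the
    -- empty family works.
    rcases Nat.eq_zero_or_pos n with h0 | h0
    · have hk : k = 0 := by omega
      rw [h0, hk]
      exact ⟨fun _ => ∅, fun i => i.elim0, fun x _ => Nat.zero_le _⟩
    have hkn := (ReuleauxPolygon.mul_le_iff_le (k := k) (n := n) hs1).2 le_rfl
    obtain ⟨lo, hi, h1, h2⟩ := S.exists_arc_covering hs hms hpriv harc (k := k) (n := n) h0
      (by rw [hms]; exact_mod_cast hkn)
    refine ReuleauxPolygon.exists_isBorsukCovering hcomp hdiam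
      (fun j => γ '' Set.Icc (lo j) (hi j)) (fun j => isCompact_Icc.image hcont) ?_ ?_ ?_
    · rintro j _ ⟨t, -, rfl⟩
      exact hmem t
    · rintro j _ ⟨a, ha, rfl⟩ _ ⟨b, hb, rfl⟩ hab
      rw [dist_eq_norm] at hab
      rcases lt_trichotomy a b with h3 | h3 | h3
      · exact h1 j a b ha.1 h3 hb.2 hab
      · exact S.irrefl a (by rwa [h3] at hab ⊢)
      · exact h1 j b a hb.1 h3 ha.2 (S.symm hab)
    · rintro x hx ⟨y, hy, hxy⟩
      obtain ⟨t, rfl⟩ := hbdry x hx ⟨y, hy, by rwa [← dist_eq_norm]⟩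
      refine (h2 t).trans (Set.ncard_le_ncard ?_ (Set.toFinite _))
      rintro j ⟨r, h3, h4⟩
      exact ⟨t + r * T, ⟨h3, h4⟩, (show Function.Periodic γ T from hper).int_mul r t⟩
  · rintro n ⟨F, hF⟩
    have h := ReuleauxPolygon.le_of_isBorsukCovering hdiam hC.1.1 hs' (fun i => γ (v i.val))
      (fun i => hmem _) (fun i => by rw [dist_eq_norm]; exact S.rel_val_add harc i) hF
    exact_mod_cast (ReuleauxPolygon.mul_le_iff_le hs1).1 h
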